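/- Let $N>2$, $1\le M\le N$, $A\in\mathbb R^{N\times N}$ and $B=(b_1,\dots,b_M)\in\mathbb R^{N\times M}$ be such that the system $\dot y=Ay+Bu$, $u\in[-1,1]^M$, is normal, i.e. $\operatorname{rank}[b_i,Ab_i,\dots,A^{N-1}b_i]=N$ for every $i$, and assume that $k:=\operatorname{rank}B\le N-1$. Let $T(x)\in[0,+\infty]$ be the minimum time in which measurable controls with values in $[-1,1]^M$ steer $x$ to the origin, and let $\mathcal R_\tau$ be the set of points that can be steered to the origin within time $\tau$. Let $\mathcal S$ be the set of points $x$ with $T(x)<\infty$ at which $T$ is non-Lipschitz, i.e. there are $p_i\ne q_i$ with $p_i\to x$, $q_i\to x$ and $\limsup_i |T(q_i)-T(p_i)|/\|q_i-p_i\|=+\infty$. For $\tau>0$ put $\mathcal S(\tau)=\mathcal S\cap\mathrm{bdry}\,\mathcal R_\tau$. Then there is $\tilde\tau>0$, depending only on $A,B,N$, such that for all $0<\tau\le\tilde\tau$: 1. for $\mathcal H^{N-1-k}$-a.e. $x\in\mathcal S(\tau)$ (hence for $\mathcal H^{N-2}$-a.e. $x\in\mathcal S(\tau)$), every neighborhood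 $V$ of $x$ satisfies $\mathcal H^{N-1-k}(V\cap\mathcal S(\tau))>0$; 2. $\mathcal H^{N-1-k}(\mathcal S(\tau))>0$; 3. if $M=1$ and $B=b$, let $\Delta=\{s\in\mathbb R^{N-2}:0<s_1<\dots<s_{N-2}<\tau\}$ and $X(s)=\int_0^\tau\gamma_s(t)e^{-tA}b\,dt$, where $\gamma_s$ equals $1$ on $(0,s_1)$ and changes sign exactly at $s_1,\dots,s_{N-2}$. Then $\Delta$ is open, and $X$ and $-X$ are injective, of class $C^\infty$ and have injective differential (rank $N-2$) on $\Delta$. Moreover, $X(\Delta)\cup(-X)(\Delta)\subseteq\mathcal S(\tau)$ and $\mathcal H^{N-2}\big(\mathcal S(\tau)\setminus(X(\Delta)\cup(-X)(\Delta))\big)=0$. -/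

import Mathlib

open MeasureTheory Set Filter Topology
open scoped Matrix ContDiff ENNReal

noncomputable section

namespace MinTime

/-- `f` is non-Lipschitz at `x`: there are sequences of distinct points `p i ≠ q i`, both
converging to `x`, along which the limsup of the difference quotients of `f` is `+∞`. -/
def NonLipschitzAt {E : Type*} [NormedAddCommGroup E] (f : E → ℝ) (x : E) : Prop :=
  ∃ p q : ℕ → E, (∀ i, p i ≠ q i) ∧ Tendsto p atTop (𝓝 x) ∧ Tendsto q atTop (𝓝 x) ∧
    limsup (fun i => ((|f (q i) - f (p i)| / ‖q i - p i‖ : ℝ) : EReal)) atTop = ⊤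

/-- The pair `(A, B)` is normal: for every column `b` of `B`,
`rank [b, A b, …, A ^ (N - 1) b] = N`. -/
def IsNormal {N M : ℕ} (A : Matrix (Fin N) (Fin N) ℝ) (B : Matrix (Fin N) (Fin M) ℝ) : Prop :=
  ∀ i : Fin M, (Matrix.of fun (r j : Fin N) => ((A ^ (j : ℕ)) *ᵥ Bᵀ i) r).rank = N

/-- Admissible controls: measurable, with values in `[-1, 1] ^ M` almost everywhere. -/
def IsAdmissible {M : ℕ} (u : ℝ → Fin M → ℝ) : Prop :=
  Measurable u ∧ ∀ᵐ s : ℝ, ∀ i, u s i ∈ Icc (-1 : ℝ) 1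

/-- `y` is the (Carathéodory) solution on `[0, ∞)` of `y' = A y + B u` a.e., `y 0 = x`,
in integral form. -/
def IsTrajectory {N M : ℕ} (A : Matrix (Fin N) (Fin N) ℝ) (B : Matrix (Fin N) (Fin M) ℝ)
    (u : ℝ → Fin M → ℝ) (x : EuclideanSpace ℝ (Fin N)) (y : ℝ → EuclideanSpace ℝ (Fin N)) :
    Prop :=
  ContinuousOn y (Ici 0) ∧
    ∀ t, 0 ≤ t → y t = x + ∫ s in (0 : ℝ)..t, WithLp.toLp 2 (A *ᵥ (y s).ofLp + B *ᵥ u s)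

/-- Some admissible control steers `x` to the origin exactly at time `t`. -/
def SteersAt {N M : ℕ} (A : Matrix (Fin N) (Fin N) ℝ) (B : Matrix (Fin N) (Fin M) ℝ)
    (x : EuclideanSpace ℝ (Fin N)) (t : ℝ) : Prop :=
  ∃ (u : ℝ → Fin M → ℝ) (y : ℝ → EuclideanSpace ℝ (Fin N)),
    IsAdmissible u ∧ IsTrajectory A B u x y ∧ y t = 0

/-- The minimum time to reach the origin; it is `⊤` if the origin cannot be reached. -/
def minTime {N M : ℕ} (A : Matrix (Fin N) (Fin N) ℝ) (B : Matrix (Fin N) (Fin M) ℝ)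
    (x : EuclideanSpace ℝ (Fin N)) : ℝ≥0∞ :=
  ⨅ (t : ℝ) (_ : 0 ≤ t) (_ : SteersAt A B x t), ENNReal.ofReal t

/-- The set of points which can be steered to the origin within time `τ`. -/
def reachSet {N M : ℕ} (A : Matrix (Fin N) (Fin N) ℝ) (B : Matrix (Fin N) (Fin M) ℝ) (τ : ℝ) :
    Set (EuclideanSpace ℝ (Fin N)) :=
  {x | ∃ t ∈ Icc (0 : ℝ) τ, SteersAt A B x t}

/-- The set of points at which the minimum time function is finite and non-Lipschitz. -/
def nonLipSet {N M : ℕ} (A : Matrix (Fin N) (Fin N) ℝ) (B : Matrix (Fin N) (Fin M) ℝ) :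
    Set (EuclideanSpace ℝ (Fin N)) :=
  {x | minTime A B x ≠ ⊤ ∧ NonLipschitzAt (fun z => (minTime A B z).toReal) x}

/-- The part of the non-Lipschitz set that lies on the boundary of the reachable set. -/
def nonLipFront {N M : ℕ} (A : Matrix (Fin N) (Fin N) ℝ) (B : Matrix (Fin N) (Fin M) ℝ)
    (τ : ℝ) : Set (EuclideanSpace ℝ (Fin N)) :=
  nonLipSet A B ∩ frontier (reachSet A B τ)

/-- Ordered switching times `0 < s₁ < ⋯ < s_d < τ`. -/
def switchingTimes (d : ℕ) (τ : ℝ) : Set (EuclideanSpace ℝ (Fin d)) :=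
  {s | (∀ i, s i ∈ Ioo 0 τ) ∧ StrictMono fun i => s i}

/-- The bang-bang control which starts from the value `1` and changes sign exactly at the
times `s i`. -/
def bangBang {d : ℕ} (s : EuclideanSpace ℝ (Fin d)) (t : ℝ) : ℝ :=
  (-1) ^ (Finset.univ.filter fun i => s i < t).card

/-- The point `∫₀^τ γ_s(t) e^{-tA} b dt`, as a function of the switching times `s`. -/
def switchingMap {N : ℕ} (A : Matrix (Fin N) (Fin N) ℝ) (b : Fin N → ℝ) (τ : ℝ) {d : ℕ}
    (s : EuclideanSpace ℝ (Fin d)) : EuclideanSpace ℝ (Fin N) :=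
  ∫ t in (0 : ℝ)..τ, bangBang s t • WithLp.toLp 2 (NormedSpace.exp (-t • A) *ᵥ b)

/-- `X`, restricted to `U`, is a smooth injectively parametrized `d`-surface. -/
def IsSmoothSurfaceOn {N d : ℕ} (X : EuclideanSpace ℝ (Fin d) → EuclideanSpace ℝ (Fin N))
    (U : Set (EuclideanSpace ℝ (Fin d))) : Prop :=
  IsOpen U ∧ ContDiffOn ℝ ∞ X U ∧ InjOn X U ∧ ∀ s ∈ U, Function.Injective (fderiv ℝ X s)

end MinTime

end

namespace MinTime

/-! Write `g_i(t) = e^{-tA} b_i`. By variation of constants, the points that can be steered to the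
origin within time τ are exactly the integrals `∫₀^τ ∑ u_i g_i`. They form a bounded, convex,
symmetric set whose support function is `∫₀^τ ∑ |⟨ζ, g_i⟩|`. Normality makes every `⟨ζ, g_i⟩` with
`ζ ≠ 0` have finitely many zeros on a short interval `[0, T]`. The maximizer in direction ζ is then
unique (`eq_extremal_of_mem_closure`) and is produced by the bang-bang control `sign ⟨ζ, g_i⟩`;
closedness of the set follows.

The support function grows with τ at rate `∑ |⟨ζ, g_i(τ)⟩|`. The minimum time is therefore
infinitely steep at a boundary point precisely when some unit normal ζ there is orthogonal to all
`g_i(τ)`: a vanishing rate gives steepness along ζ (`mem_nonLipFront_of_normal`), and steep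
difference quotients give normals with small rate, which have a limit
(`exists_normal_of_mem_nonLipFront`).

For positive measure, project the reachable set onto the orthogonal complement `V` of the `g_i(τ)`,
of dimension at least `N - k`. Supporting normals of the projection lie in `V`, so its whole
frontier lifts to the non-Lipschitz front, and a further linear projection of that frontier covers
an open subset of `ℝ^(N-1-k)` (`hausdorffMeasure_nonLipFront_pos`). Positivity of the local measure
at almost every point holds for any set and any measure on a second countable space
(`ae_pos_measure_nhds_inter`).

For a single input, Rolle's theorem and a continuity argument for the Kalman determinant show that
`⟨ζ, g⟩` has at most `N - 1` zeros on `[0, T]`, all simple if there are `N - 1` (`IsDisconjugate`).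
On the front, τ is one of them, so at most `N - 2` switchings remain. Exactly `N - 2` switchings
give `±X`, and any such switching times occur. Fewer switchings give integer combinations of at most
`N - 3` values of a smooth curve, a set of dimension at most `N - 3`. The zero count also makes the
vectors `g(s_j)` independent, hence `X` an immersion, and simplicity of the zeros makes `X`
injective. -/

open scoped Matrix.Norms.Operator in
theorem toLp_exp_mulVec {N : ℕ} (A : Matrix (Fin N) (Fin N) ℝ) (v : Fin N → ℝ) :
    WithLp.toLp 2 (NormedSpace.exp A *ᵥ v) =
      NormedSpace.exp (Matrix.toEuclideanCLM (𝕜 := ℝ) A) (WithLp.toLp 2 v) := by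
  let φ := (Matrix.toEuclideanCLM (n := Fin N) (𝕜 := ℝ))
  have hc : Continuous φ :=
    LinearMap.continuous_of_finiteDimensional (φ.toAlgEquiv.toLinearMap)
  rw [← Matrix.toEuclideanCLM_toLp]
  congr 1
  exact NormedSpace.map_exp φ hc A

/-! ### Exponential of the drift and integration by parts against integrable forcing. -/

section Exponential

variable {E : Type*} [NormedAddCommGroup E] [NormedSpace ℝ E] [CompleteSpace E]

theorem hasDerivAt_exp_neg_smul (A : E →L[ℝ] E) (t : ℝ) :
    HasDerivAt (fun s : ℝ => NormedSpace.exp ((-s) • A))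
      (-(NormedSpace.exp ((-t) • A) * A)) t := by
  have h := (hasDerivAt_exp_smul_const A (-t)).scomp t (hasDerivAt_neg t)
  rw [neg_smul, one_smul] at h
  exact h

theorem contDiff_exp_neg_smul (A : E →L[ℝ] E) :
    ContDiff ℝ ∞ (fun s : ℝ => NormedSpace.exp ((-s) • A)) := by
  have h : ContDiff ℝ ∞ (NormedSpace.exp : (E →L[ℝ] E) → (E →L[ℝ] E)) := by
    rw [contDiff_iff_contDiffAt]
    exact fun x => (NormedSpace.exp_analytic (𝕂 := ℝ) x).contDiffAt
  exact h.comp (contDiff_neg.smul contDiff_const)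

theorem continuous_exp_neg_smul (A : E →L[ℝ] E) :
    Continuous (fun s : ℝ => NormedSpace.exp ((-s) • A)) :=
  (contDiff_exp_neg_smul A).continuous

theorem exp_smul_mul_exp_neg_smul (A : E →L[ℝ] E) (t : ℝ) :
    NormedSpace.exp (t • A) * NormedSpace.exp ((-t) • A) = 1 := by
  let _ : NormedAlgebra ℚ (E →L[ℝ] E) := NormedAlgebra.restrictScalars ℚ ℝ _
  rw [neg_smul, ← NormedSpace.exp_add_of_commute (Commute.neg_right (Commute.refl _))]
  simp

end Exponential

/-- Controls are only measurable, so the primitive of `h` is only absolutely continuous; the product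
rule is applied in that class. -/
theorem mul_integral_eq_integral_deriv_mul_add {p p' h : ℝ → ℝ} {t : ℝ}
    (hp : ∀ t, HasDerivAt p (p' t) t) (hp' : Continuous p')
    (hh : IntervalIntegrable h volume 0 t) :
    p t * (∫ s in (0 : ℝ)..t, h s) =
      (∫ s in (0 : ℝ)..t, p' s * ∫ r in (0 : ℝ)..s, h r) + ∫ s in (0 : ℝ)..t, p s * h s := by
  have hH := hh.absolutelyContinuousOnInterval_intervalIntegral (c := 0) left_mem_uIcc
  have hdp : deriv p = p' := funext fun s => (hp s).deriv
  have hpc : Continuous p := continuous_iff_continuousAt.2 fun s => (hp s).continuousAt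
  have hpa : AbsolutelyContinuousOnInterval p 0 t := by
    refine ContDiffOn.absolutelyContinuousOnInterval (ContDiff.contDiffOn ?_)
    exact contDiff_one_iff_deriv.2 ⟨fun s => (hp s).differentiableAt, hdp ▸ hp'⟩
  have key := hpa.integral_deriv_mul_eq_sub hH
  have hint : IntervalIntegrable (fun s => p s * h s) volume 0 t :=
    hh.continuousOn_mul hpc.continuousOn
  have hint' : IntervalIntegrable (fun s => p' s * ∫ r in (0 : ℝ)..s, h r) volume 0 t :=
    (hp'.continuousOn.mul hH.continuousOn).intervalIntegrable
  simp only [intervalIntegral.integral_same, mul_zero, sub_zero] at key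
  rw [← key, ← intervalIntegral.integral_add hint' hint]
  refine intervalIntegral.integral_congr_ae ?_
  filter_upwards [hh.ae_hasDerivAt_integral] with s hs hsm
  rw [hdp, (hs (uIoc_subset_uIcc hsm) 0 left_mem_uIcc).deriv]

theorem intervalIntegrable_clm_apply {E : Type*} [NormedAddCommGroup E] [InnerProductSpace ℝ E]
    [FiniteDimensional ℝ E] {F : ℝ → E →L[ℝ] E} {h : ℝ → E} {a b : ℝ} (hF : Continuous F)
    (hh : IntervalIntegrable h volume a b) :
    IntervalIntegrable (fun s => F s (h s)) volume a b := by
  let e := stdOrthonormalBasis ℝ E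
  have : (fun s => F s (h s)) = ∑ j, fun s => (inner ℝ (e j) (h s)) • F s (e j) := by
    ext1 s
    conv_lhs => rw [← e.sum_repr' (h s)]
    simp [map_sum]
  rw [this]
  refine IntervalIntegrable.sum _ fun j _ => ?_
  exact IntervalIntegrable.smul_continuousOn
    (f := fun s => inner ℝ (e j) (h s)) ⟨hh.1.const_inner _, hh.2.const_inner _⟩
    (hF.clm_apply continuous_const).continuousOn

/-- Reduces to the scalar identity for the matrix coefficients `⟨ζ, F s (e j)⟩` in an orthonormal
basis. -/
theorem clm_apply_integral_eq {E : Type*} [NormedAddCommGroup E] [InnerProductSpace ℝ E]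
    [FiniteDimensional ℝ E] {F F' : ℝ → E →L[ℝ] E} {h : ℝ → E} {t : ℝ}
    (hF : ∀ t, HasDerivAt F (F' t) t) (hF' : Continuous F')
    (hh : IntervalIntegrable h volume 0 t) :
    F t (∫ s in (0 : ℝ)..t, h s) =
      (∫ s in (0 : ℝ)..t, F' s (∫ r in (0 : ℝ)..s, h r)) + ∫ s in (0 : ℝ)..t, F s (h s) := by
  have hFc : Continuous F := continuous_iff_continuousAt.2 fun s => (hF s).continuousAt
  have hHc : ContinuousOn (fun s => ∫ r in (0 : ℝ)..s, h r) (uIcc 0 t) :=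
    intervalIntegral.continuousOn_primitive_interval' hh left_mem_uIcc
  have hi1 : IntervalIntegrable (fun s => F' s (∫ r in (0 : ℝ)..s, h r)) volume 0 t :=
    (hF'.continuousOn.clm_apply hHc).intervalIntegrable
  let e := stdOrthonormalBasis ℝ E
  have hexp : ∀ (ζ : E) (L : E →L[ℝ] E) (v : E),
      inner ℝ ζ (L v) = ∑ j, inner ℝ ζ (L (e j)) * inner ℝ (e j) v := by
    intro ζ L v
    conv_lhs => rw [← e.sum_repr' v]
    simp [map_sum, inner_sum, inner_smul_right, mul_comm]
  have hcomp : ∀ j, IntervalIntegrable (fun s => inner ℝ (e j) (h s)) volume 0 t := fun j =>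
    ⟨hh.1.const_inner _, hh.2.const_inner _⟩
  have hi2 := intervalIntegrable_clm_apply hFc hh
  refine ext_inner_left ℝ fun ζ => ?_
  have hpull : ∀ (w : E) (f : ℝ → E) (s : ℝ), IntervalIntegrable f volume 0 s →
      inner ℝ w (∫ r in (0 : ℝ)..s, f r) = ∫ r in (0 : ℝ)..s, inner ℝ w (f r) := by
    intro w f s hf
    exact ((innerSL ℝ w).intervalIntegral_comp_comm hf).symm
  have hsub : ∀ s ∈ uIcc 0 t, IntervalIntegrable h volume 0 s := fun s hs =>
    hh.mono_set (uIcc_subset_uIcc left_mem_uIcc hs)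
  rw [inner_add_right, hpull _ _ _ hi1, hpull _ _ _ hi2, hexp]
  rw [show (fun s => inner ℝ ζ (F' s (∫ r in (0 : ℝ)..s, h r))) = _ from
      funext fun s => hexp ζ (F' s) _,
    show (fun s => inner ℝ ζ (F s (h s))) = _ from funext fun s => hexp ζ (F s) _]
  have hder : ∀ j s, HasDerivAt (fun r => inner ℝ ζ (F r (e j))) (inner ℝ ζ (F' s (e j))) s := by
    intro j s
    exact (innerSL ℝ ζ).hasFDerivAt.comp_hasDerivAt s ((hF s).clm_apply (hasDerivAt_const s (e j)))
      |>.congr_deriv (by simp)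
  have hdc : ∀ j, Continuous fun s => inner ℝ ζ (F' s (e j)) := fun j =>
    continuous_const.inner (hF'.clm_apply continuous_const)
  have hpc : ∀ j, Continuous fun s => inner ℝ ζ (F s (e j)) := fun j =>
    continuous_const.inner (hFc.clm_apply continuous_const)
  rw [intervalIntegral.integral_finsetSum, intervalIntegral.integral_finsetSum,
    ← Finset.sum_add_distrib]
  · refine Finset.sum_congr rfl fun j _ => ?_
    rw [hpull _ _ _ hh, mul_integral_eq_integral_deriv_mul_add (hder j) (hdc j) (hcomp j)]
    congr 1
    refine intervalIntegral.integral_congr fun s hs => ?_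
    rw [hpull _ _ _ (hsub s hs)]
  · intro j _
    exact (hcomp j).continuousOn_mul (hpc j).continuousOn
  · intro j _
    exact ((hdc j).continuousOn.mul (continuousOn_const.inner hHc)).intervalIntegrable

/-! ### Variation of constants and the integral form of steering. -/

section VariationOfConstants

variable {E : Type*} [NormedAddCommGroup E] [InnerProductSpace ℝ E] [FiniteDimensional ℝ E]

/-- Integration by parts against `e^{-sA}` cancels the terms in `A y`; the leftover `e^{-sA} A x` is
exactly what turns `e^{-tA} x` back into `x`. -/
theorem exp_neg_smul_apply_eq_of_integral_eq (A : E →L[ℝ] E) {w y : ℝ → E} {x : E}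
    (hw : ∀ t, IntervalIntegrable w volume 0 t) (hy : ContinuousOn y (Ici 0))
    (hyx : ∀ t, 0 ≤ t → y t = x + ∫ s in (0 : ℝ)..t, (A (y s) + w s)) {t : ℝ} (ht : 0 ≤ t) :
    NormedSpace.exp ((-t) • A) (y t) =
      x + ∫ s in (0 : ℝ)..t, NormedSpace.exp ((-s) • A) (w s) := by
  have hsub : uIcc 0 t ⊆ Ici 0 := by rw [uIcc_of_le ht]; exact Icc_subset_Ici_self
  have hAy : IntervalIntegrable (fun s => A (y s)) volume 0 t :=
    (A.continuous.comp_continuousOn (hy.mono hsub)).intervalIntegrable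
  have hh : IntervalIntegrable (fun s => A (y s) + w s) volume 0 t := hAy.add (hw t)
  have hd : Continuous fun s : ℝ => -(NormedSpace.exp ((-s) • A) * A) :=
    ((continuous_exp_neg_smul A).mul continuous_const).neg
  have key := clm_apply_integral_eq (hasDerivAt_exp_neg_smul A) hd hh
  have h1 : IntervalIntegrable (fun s => NormedSpace.exp ((-s) • A) (A (y s))) volume 0 t :=
    ((continuous_exp_neg_smul A).continuousOn.clm_apply
      (A.continuous.comp_continuousOn (hy.mono hsub))).intervalIntegrable
  have h2 : IntervalIntegrable (fun s => NormedSpace.exp ((-s) • A) (A x)) volume 0 t :=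
    ((continuous_exp_neg_smul A).clm_apply continuous_const).intervalIntegrable _ _
  have hFw : IntervalIntegrable (fun s => NormedSpace.exp ((-s) • A) (w s)) volume 0 t :=
    intervalIntegrable_clm_apply (continuous_exp_neg_smul A) (hw t)
  have hx : NormedSpace.exp ((-t) • A) x =
      x - ∫ s in (0 : ℝ)..t, NormedSpace.exp ((-s) • A) (A x) := by
    have := intervalIntegral.integral_eq_sub_of_hasDerivAt (a := 0) (b := t)
      (f := fun s : ℝ => NormedSpace.exp ((-s) • A) x)
      (f' := fun s => -(NormedSpace.exp ((-s) • A) (A x))) (fun s _ => by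
        simpa using (hasDerivAt_exp_neg_smul A s).clm_apply (hasDerivAt_const s x)) h2.neg
    rw [intervalIntegral.integral_neg] at this
    simp only [neg_zero, zero_smul, NormedSpace.exp_zero, one_apply_eq_self] at this
    rw [eq_sub_iff_add_eq, ← sub_eq_zero]
    have h3 := congrArg (· + ∫ s in (0 : ℝ)..t, NormedSpace.exp ((-s) • A) (A x)) this
    simp only [neg_add_cancel] at h3
    rw [h3]; abel
  rw [hyx t ht, map_add, key, hx]
  have e1 : (∫ s in (0 : ℝ)..t, (-(NormedSpace.exp ((-s) • A) * A))
      (∫ r in (0 : ℝ)..s, (A (y r) + w r))) =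
      (∫ s in (0 : ℝ)..t, NormedSpace.exp ((-s) • A) (A x)) -
        ∫ s in (0 : ℝ)..t, NormedSpace.exp ((-s) • A) (A (y s)) := by
    rw [← intervalIntegral.integral_sub h2 h1]
    refine intervalIntegral.integral_congr fun s hs => ?_
    have : (∫ r in (0 : ℝ)..s, (A (y r) + w r)) = y s - x := by
      rw [hyx s (hsub hs)]; abel
    simp only [this]
    simp
  have e2 : (∫ s in (0 : ℝ)..t, NormedSpace.exp ((-s) • A) (A (y s) + w s)) =
      (∫ s in (0 : ℝ)..t, NormedSpace.exp ((-s) • A) (A (y s))) +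
        ∫ s in (0 : ℝ)..t, NormedSpace.exp ((-s) • A) (w s) := by
    simp_rw [map_add]
    exact intervalIntegral.integral_add h1 hFw
  rw [e1, e2]
  abel

theorem continuous_exp_smul (A : E →L[ℝ] E) :
    Continuous (fun s : ℝ => NormedSpace.exp (s • A)) := by
  simpa using (differentiable_exp_smul_const ℝ A).continuous

theorem exp_smul_apply_integral_eq (A : E →L[ℝ] E) {w : ℝ → E} (x : E)
    (hw : ∀ t, IntervalIntegrable w volume 0 t) (t : ℝ) :
    NormedSpace.exp (t • A) (x + ∫ s in (0 : ℝ)..t, NormedSpace.exp ((-s) • A) (w s)) =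
      x + ∫ s in (0 : ℝ)..t, (A (NormedSpace.exp (s • A)
        (x + ∫ r in (0 : ℝ)..s, NormedSpace.exp ((-r) • A) (w r))) + w s) := by
  have hW : ∀ t, IntervalIntegrable (fun s => NormedSpace.exp ((-s) • A) (w s)) volume 0 t :=
    fun t => intervalIntegrable_clm_apply (continuous_exp_neg_smul A) (hw t)
  have hder : ∀ t : ℝ, HasDerivAt (fun s : ℝ => NormedSpace.exp (s • A))
      (A * NormedSpace.exp (t • A)) t := hasDerivAt_exp_smul_const' A
  have hd : Continuous fun s : ℝ => A * NormedSpace.exp (s • A) :=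
    continuous_const.mul (continuous_exp_smul A)
  have hprim : ContinuousOn (fun s => ∫ r in (0 : ℝ)..s, NormedSpace.exp ((-r) • A) (w r))
      (uIcc 0 t) := intervalIntegral.continuousOn_primitive_interval' (hW t) left_mem_uIcc
  have h1 : IntervalIntegrable (fun s => A (NormedSpace.exp (s • A)
      (∫ r in (0 : ℝ)..s, NormedSpace.exp ((-r) • A) (w r)))) volume 0 t :=
    (A.continuous.comp_continuousOn
      ((continuous_exp_smul A).continuousOn.clm_apply hprim)).intervalIntegrable
  have h2 : IntervalIntegrable (fun s => A (NormedSpace.exp (s • A) x)) volume 0 t :=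
    (A.continuous.comp ((continuous_exp_smul A).clm_apply continuous_const)).intervalIntegrable _ _
  have hx : NormedSpace.exp (t • A) x =
      x + ∫ s in (0 : ℝ)..t, A (NormedSpace.exp (s • A) x) := by
    have := intervalIntegral.integral_eq_sub_of_hasDerivAt (a := 0) (b := t)
      (f := fun s : ℝ => NormedSpace.exp (s • A) x)
      (f' := fun s => A (NormedSpace.exp (s • A) x)) (fun s _ => by
        simpa using (hder s).clm_apply (hasDerivAt_const s x)) h2
    rw [this]
    simp
  have hcancel : ∀ s, NormedSpace.exp (s • A) (NormedSpace.exp ((-s) • A) (w s)) = w s := by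
    intro s
    simpa using DFunLike.congr_fun (exp_smul_mul_exp_neg_smul A s) (w s)
  rw [map_add, clm_apply_integral_eq hder hd (hW t), hx]
  simp_rw [hcancel, map_add]
  rw [intervalIntegral.integral_add (h2.add h1) (hw t), intervalIntegral.integral_add h2 h1]
  simp only [mul_apply_eq_comp]
  abel

end VariationOfConstants

section Reach

variable {N M : ℕ}

/-- The columns `e^{-tA} b_i` of the control operator transported to time zero. -/
noncomputable def columnFlow (A : Matrix (Fin N) (Fin N) ℝ) (B : Matrix (Fin N) (Fin M) ℝ)
    (i : Fin M) (t : ℝ) : EuclideanSpace ℝ (Fin N) :=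
  WithLp.toLp 2 (NormedSpace.exp (-t • A) *ᵥ Bᵀ i)

theorem columnFlow_eq_exp_apply (A : Matrix (Fin N) (Fin N) ℝ) (B : Matrix (Fin N) (Fin M) ℝ)
    (i : Fin M) (t : ℝ) :
    columnFlow A B i t =
      NormedSpace.exp ((-t) • Matrix.toEuclideanCLM (𝕜 := ℝ) A) (WithLp.toLp 2 (Bᵀ i)) := by
  rw [columnFlow, toLp_exp_mulVec, map_smul]

theorem contDiff_columnFlow (A : Matrix (Fin N) (Fin N) ℝ) (B : Matrix (Fin N) (Fin M) ℝ)
    (i : Fin M) : ContDiff ℝ ∞ (columnFlow A B i) := by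
  rw [funext (columnFlow_eq_exp_apply A B i)]
  exact (contDiff_exp_neg_smul _).clm_apply contDiff_const

theorem toLp_mulVec_eq_sum (B : Matrix (Fin N) (Fin M) ℝ) (v : Fin M → ℝ) :
    WithLp.toLp 2 (B *ᵥ v) = ∑ i, v i • WithLp.toLp 2 (Bᵀ i) := by
  ext r
  simp [Matrix.mulVec, dotProduct, mul_comm]

theorem IsAdmissible.intervalIntegrable_toLp_mulVec {u : ℝ → Fin M → ℝ} (hu : IsAdmissible u)
    (B : Matrix (Fin N) (Fin M) ℝ) (a b : ℝ) :
    IntervalIntegrable (fun s => WithLp.toLp 2 (B *ᵥ u s)) volume a b := by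
  simp_rw [toLp_mulVec_eq_sum]
  have : (fun s => ∑ i, u s i • WithLp.toLp 2 (Bᵀ i)) =
      ∑ i, fun s => u s i • WithLp.toLp 2 (Bᵀ i) := by ext1 s; simp
  rw [this]
  refine IntervalIntegrable.sum _ fun i _ => ?_
  refine IntervalIntegrable.smul_continuousOn (f := fun s => u s i) ?_ continuousOn_const
  have hm : Measurable fun s => u s i := (measurable_pi_apply i).comp hu.1
  refine IntervalIntegrable.mono_fun' (g := fun _ => (1 : ℝ)) intervalIntegrable_const
    hm.aestronglyMeasurable ?_
  filter_upwards [ae_restrict_of_ae hu.2] with s hs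
  exact abs_le.2 (hs i)

theorem exp_apply_toLp_mulVec (A : Matrix (Fin N) (Fin N) ℝ) (B : Matrix (Fin N) (Fin M) ℝ)
    (v : Fin M → ℝ) (s : ℝ) :
    NormedSpace.exp ((-s) • Matrix.toEuclideanCLM (𝕜 := ℝ) A) (WithLp.toLp 2 (B *ᵥ v)) =
      ∑ i, v i • columnFlow A B i s := by
  simp [toLp_mulVec_eq_sum, columnFlow_eq_exp_apply, map_sum]

theorem IsAdmissible.neg {u : ℝ → Fin M → ℝ} (hu : IsAdmissible u) : IsAdmissible (-u) := by
  refine ⟨hu.1.neg, ?_⟩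
  filter_upwards [hu.2] with s hs i
  have := hs i
  simp only [Pi.neg_apply, mem_Icc] at this ⊢
  constructor <;> linarith [this.1, this.2]

/-- Reaching zero means `x = -∫ e^{-sA} B u`; the minus sign is absorbed by `u ↦ -u`, as the control
box is symmetric. -/
theorem steersAt_iff (A : Matrix (Fin N) (Fin N) ℝ) (B : Matrix (Fin N) (Fin M) ℝ)
    (x : EuclideanSpace ℝ (Fin N)) {t : ℝ} (ht : 0 ≤ t) :
    SteersAt A B x t ↔ ∃ u : ℝ → Fin M → ℝ, IsAdmissible u ∧
      x = ∫ s in (0 : ℝ)..t, ∑ i, u s i • columnFlow A B i s := by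
  have hsplit : ∀ (y : EuclideanSpace ℝ (Fin N)) (v : Fin M → ℝ),
      WithLp.toLp 2 (A *ᵥ y.ofLp + B *ᵥ v) =
        Matrix.toEuclideanCLM (𝕜 := ℝ) A y + WithLp.toLp 2 (B *ᵥ v) := by
    intro y v
    rw [WithLp.toLp_add, ← Matrix.toEuclideanCLM_toLp]
  constructor
  · rintro ⟨u, y, hu, ⟨hyc, hy⟩, hyt⟩
    simp_rw [hsplit] at hy
    have := exp_neg_smul_apply_eq_of_integral_eq _
      (fun t => hu.intervalIntegrable_toLp_mulVec B 0 t) hyc hy ht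
    rw [hyt, map_zero] at this
    simp_rw [exp_apply_toLp_mulVec] at this
    refine ⟨-u, hu.neg, ?_⟩
    simp only [Pi.neg_apply, neg_smul, Finset.sum_neg_distrib, intervalIntegral.integral_neg]
    exact eq_neg_of_add_eq_zero_left this.symm
  · rintro ⟨u, hu, hx⟩
    have hw := fun t => hu.neg.intervalIntegrable_toLp_mulVec B 0 t
    have key := exp_smul_apply_integral_eq (Matrix.toEuclideanCLM (𝕜 := ℝ) A) x hw
    refine ⟨-u, fun s => NormedSpace.exp (s • Matrix.toEuclideanCLM (𝕜 := ℝ) A)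
      (x + ∫ r in (0 : ℝ)..s, NormedSpace.exp ((-r) • Matrix.toEuclideanCLM (𝕜 := ℝ) A)
        (WithLp.toLp 2 (B *ᵥ (-u) r))), hu.neg, ⟨?_, fun t _ => ?_⟩, ?_⟩
    · refine Continuous.continuousOn ((continuous_exp_smul _).clm_apply (continuous_const.add ?_))
      refine intervalIntegral.continuous_primitive (fun a b => ?_) 0
      exact intervalIntegrable_clm_apply (continuous_exp_neg_smul _)
        (hu.neg.intervalIntegrable_toLp_mulVec B a b)
    · simp_rw [hsplit]
      exact key t
    · simp_rw [exp_apply_toLp_mulVec]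
      simp only [Pi.neg_apply, neg_smul, Finset.sum_neg_distrib, intervalIntegral.integral_neg]
      rw [← hx]
      simp

end Reach

/-! ### Supporting normals and interiors of convex sets. -/

section Convexity

variable {E : Type*} [NormedAddCommGroup E] [InnerProductSpace ℝ E] [FiniteDimensional ℝ E]

/-- Hahn–Banach separates the point from the interior, and the inequality extends because the
interior of a convex body is dense in its closure. -/
theorem exists_unit_normal_of_notMem_interior {s : Set E} (hs : Convex ℝ s)
    (hne : (interior s).Nonempty) {x : E} (hx : x ∉ interior s) :
    ∃ ζ : E, ‖ζ‖ = 1 ∧ ∀ z ∈ closure s, inner ℝ ζ z ≤ inner ℝ ζ x := by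
  obtain ⟨f, hf⟩ := geometric_hahn_banach_open_point hs.interior isOpen_interior hx
  set ξ := (InnerProductSpace.toDual ℝ E).symm f with hξ
  have hξf : ∀ z, inner ℝ ξ z = f z := fun z => by
    simp [hξ, InnerProductSpace.toDual_symm_apply]
  have hξ0 : ξ ≠ 0 := by
    intro h0
    obtain ⟨z, hz⟩ := hne
    have := hf z hz
    rw [← hξf, ← hξf, h0] at this
    simp at this
  have hpos : 0 < ‖ξ‖ := norm_pos_iff.2 hξ0
  refine ⟨(‖ξ‖⁻¹ : ℝ) • ξ, by simp [norm_smul, hpos.ne'], fun z hz => ?_⟩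
  have hle : f z ≤ f x := by
    rw [← hs.closure_interior_eq_closure_of_nonempty_interior hne] at hz
    exact closure_minimal (fun w hw => (hf w hw).le) (isClosed_Iic.preimage f.continuous) hz
  simp only [inner_smul_left, hξf, conj_trivial]
  gcongr

/-- In finite dimension a convex set that spans has an interior point, and the origin is the
midpoint of that point and its reflection. -/
theorem zero_mem_interior_of_symmetric {s : Set E} (hs : Convex ℝ s) (h0 : (0 : E) ∈ s)
    (hneg : ∀ x ∈ s, -x ∈ s) (hspan : ∀ ζ : E, ζ ≠ 0 → ∃ x ∈ s, inner ℝ ζ x ≠ 0) :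
    (0 : E) ∈ interior s := by
  have htop : affineSpan ℝ s = ⊤ := by
    rw [AffineSubspace.affineSpan_eq_top_iff_vectorSpan_eq_top_of_nonempty ℝ E E ⟨0, h0⟩,
      vectorSpan_eq_span_vsub_set_right ℝ h0]
    simp only [vsub_eq_sub, sub_zero, image_id']
    rw [← Submodule.orthogonal_eq_bot_iff, Submodule.eq_bot_iff]
    intro ζ hζ
    by_contra hne
    obtain ⟨x, hx, hxζ⟩ := hspan ζ hne
    exact hxζ ((Submodule.mem_orthogonal' _ _).1 hζ x (Submodule.subset_span hx))
  obtain ⟨x, hx⟩ := hs.interior_nonempty_iff_affineSpan_eq_top.2 htop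
  have hnx : -x ∈ interior s := by
    have hopen : IsOpen (Neg.neg ⁻¹' interior s) := isOpen_interior.preimage continuous_neg
    refine interior_maximal (fun z hz => ?_) hopen (show - -x ∈ interior s by rwa [neg_neg])
    simpa using hneg _ (interior_subset hz)
  have := hs.interior hx hnx (a := 1 / 2) (b := 1 / 2) (by norm_num) (by norm_num) (by norm_num)
  simpa using this

end Convexity

/-! ### The set of control integrals, its support function and its extremal points. -/

section SteerSet

variable {E : Type*} [NormedAddCommGroup E] [InnerProductSpace ℝ E]
variable {M : ℕ}

/-- The points `∫ₐᵇ ∑ uᵢ gᵢ` obtained from admissible controls `u`. -/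
def steerSet (g : Fin M → ℝ → E) (a b : ℝ) : Set E :=
  {x | ∃ u : ℝ → Fin M → ℝ, IsAdmissible u ∧ x = ∫ s in a..b, ∑ i, u s i • g i s}

/-- The support function of `steerSet g a b`. -/
noncomputable def steerSupport (g : Fin M → ℝ → E) (a b : ℝ) (ζ : E) : ℝ :=
  ∫ s in a..b, ∑ i, |inner ℝ ζ (g i s)|

/-- The sign of a real number, with value `-1` at zero. -/
noncomputable def signPM (r : ℝ) : ℝ := if 0 < r then 1 else -1

/-- The point of `steerSet g a b` at which `inner ℝ ζ` is maximal. -/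
noncomputable def extremal (g : Fin M → ℝ → E) (a b : ℝ) (ζ : E) : E :=
  ∫ s in a..b, ∑ i, signPM (inner ℝ ζ (g i s)) • g i s

/-- No nonzero linear functional vanishes at infinitely many times of `[a, b]` along some `gᵢ`. -/
def FinitelyManySwitches (g : Fin M → ℝ → E) (a b : ℝ) : Prop :=
  ∀ ζ : E, ζ ≠ 0 → ∀ i, {s ∈ Icc a b | inner ℝ ζ (g i s) = 0}.Finite

theorem signPM_eq_or (r : ℝ) : signPM r = 1 ∨ signPM r = -1 := by
  unfold signPM; split_ifs <;> simp

theorem signPM_mul_self (r : ℝ) : signPM r * r = |r| := by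
  unfold signPM
  split_ifs with h
  · rw [abs_of_pos h, one_mul]
  · rw [abs_of_nonpos (not_lt.1 h), neg_one_mul]

theorem measurable_signPM : Measurable signPM :=
  Measurable.ite measurableSet_Ioi measurable_const measurable_const

theorem FinitelyManySwitches.mono {g : Fin M → ℝ → E} {a b a' b' : ℝ}
    (h : FinitelyManySwitches g a b) (ha : a ≤ a') (hb : b' ≤ b) :
    FinitelyManySwitches g a' b' := fun ζ hζ i =>
  (h ζ hζ i).subset fun _ hs => ⟨⟨ha.trans hs.1.1, hs.1.2.trans hb⟩, hs.2⟩

variable {g : Fin M → ℝ → E}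

theorem IsAdmissible.intervalIntegrable {u : ℝ → Fin M → ℝ} (hu : IsAdmissible u)
    (hg : ∀ i, Continuous (g i)) (a b : ℝ) :
    IntervalIntegrable (fun s => ∑ i, u s i • g i s) volume a b := by
  have : (fun s => ∑ i, u s i • g i s) = ∑ i, fun s => u s i • g i s := by ext1 s; simp
  rw [this]
  refine IntervalIntegrable.sum _ fun i _ => ?_
  refine IntervalIntegrable.smul_continuousOn (f := fun s => u s i) ?_ (hg i).continuousOn
  have hm : Measurable fun s => u s i := (measurable_pi_apply i).comp hu.1
  refine IntervalIntegrable.mono_fun' (g := fun _ => (1 : ℝ)) intervalIntegrable_const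
    hm.aestronglyMeasurable ?_
  filter_upwards [ae_restrict_of_ae hu.2] with s hs
  exact abs_le.2 (hs i)

theorem isAdmissible_signPM (hg : ∀ i, Continuous (g i)) (ζ : E) :
    IsAdmissible fun s i => signPM (inner ℝ ζ (g i s)) := by
  refine ⟨measurable_pi_lambda _ fun i => measurable_signPM.comp
    (continuous_const.inner (hg i)).measurable, ae_of_all _ fun s i => ?_⟩
  rcases signPM_eq_or (inner ℝ ζ (g i s)) with h | h <;> simp only [h, mem_Icc] <;> norm_num

theorem continuous_sum_abs_inner (hg : ∀ i, Continuous (g i)) (ζ : E) :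
    Continuous fun s => ∑ i, |inner ℝ ζ (g i s)| :=
  continuous_finsetSum _ fun i _ => (continuous_const.inner (hg i)).abs

theorem extremal_mem_steerSet (hg : ∀ i, Continuous (g i)) (a b : ℝ) (ζ : E) :
    extremal g a b ζ ∈ steerSet g a b := ⟨_, isAdmissible_signPM hg ζ, rfl⟩

theorem zero_mem_steerSet (g : Fin M → ℝ → E) (a b : ℝ) : (0 : E) ∈ steerSet g a b :=
  ⟨0, ⟨measurable_const, ae_of_all _ fun s i => by simp⟩, by simp⟩

theorem neg_mem_steerSet {a b : ℝ} {x : E} (hx : x ∈ steerSet g a b) : -x ∈ steerSet g a b := by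
  obtain ⟨u, hu, rfl⟩ := hx
  exact ⟨-u, hu.neg, by simp [intervalIntegral.integral_neg]⟩

theorem convex_steerSet (hg : ∀ i, Continuous (g i)) (a b : ℝ) : Convex ℝ (steerSet g a b) := by
  rintro _ ⟨u, hu, rfl⟩ _ ⟨v, hv, rfl⟩ p q hp hq hpq
  refine ⟨p • u + q • v, ⟨(hu.1.const_smul p).add (hv.1.const_smul q), ?_⟩, ?_⟩
  · filter_upwards [hu.2, hv.2] with s hs hs' i
    exact convex_Icc (-1 : ℝ) 1 (hs i) (hs' i) hp hq hpq
  · have h1 : IntervalIntegrable (fun s => p • ∑ i, u s i • g i s) volume a b :=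
      (hu.intervalIntegrable hg a b).smul p
    have h2 : IntervalIntegrable (fun s => q • ∑ i, v s i • g i s) volume a b :=
      (hv.intervalIntegrable hg a b).smul q
    rw [← intervalIntegral.integral_smul, ← intervalIntegral.integral_smul,
      ← intervalIntegral.integral_add h1 h2]
    refine intervalIntegral.integral_congr fun s _ => ?_
    simp [add_smul, Finset.sum_add_distrib, Finset.smul_sum, smul_smul]

theorem add_mem_steerSet (hg : ∀ i, Continuous (g i)) {a b c : ℝ} (hab : a ≤ b) (hbc : b ≤ c)
    {x y : E} (hx : x ∈ steerSet g a b) (hy : y ∈ steerSet g b c) : x + y ∈ steerSet g a c := by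
  obtain ⟨u, hu, rfl⟩ := hx
  obtain ⟨v, hv, rfl⟩ := hy
  have hw : IsAdmissible fun s => if s ≤ b then u s else v s := by
    refine ⟨Measurable.ite measurableSet_Iic hu.1 hv.1, ?_⟩
    filter_upwards [hu.2, hv.2] with s hs hs'
    split_ifs <;> assumption
  refine ⟨_, hw, ?_⟩
  rw [← intervalIntegral.integral_add_adjacent_intervals (hw.intervalIntegrable hg a b)
    (hw.intervalIntegrable hg b c)]
  congr 1
  · refine intervalIntegral.integral_congr fun s hs => ?_
    rw [uIcc_of_le hab] at hs
    simp [hs.2]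
  · refine intervalIntegral.integral_congr_ae (ae_of_all _ fun s hs => ?_)
    rw [uIoc_of_le hbc] at hs
    simp [not_le.2 hs.1]

theorem steerSet_mono (hg : ∀ i, Continuous (g i)) {a b c : ℝ} (hab : a ≤ b) (hbc : b ≤ c) :
    steerSet g a b ⊆ steerSet g a c := fun x hx => by
  simpa using add_mem_steerSet hg hab hbc hx (zero_mem_steerSet g b c)

theorem inner_integral_control [CompleteSpace E] {u : ℝ → Fin M → ℝ} (hu : IsAdmissible u)
    (hg : ∀ i, Continuous (g i)) (a b : ℝ) (ζ : E) :
    inner ℝ ζ (∫ s in a..b, ∑ i, u s i • g i s) =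
      ∫ s in a..b, ∑ i, u s i * inner ℝ ζ (g i s) := by
  have := ((innerSL ℝ ζ).intervalIntegral_comp_comm (hu.intervalIntegrable hg a b)).symm
  simpa [inner_sum, inner_smul_right] using this

theorem IsAdmissible.intervalIntegrable_inner {u : ℝ → Fin M → ℝ} (hu : IsAdmissible u)
    (hg : ∀ i, Continuous (g i)) (a b : ℝ) (ζ : E) :
    IntervalIntegrable (fun s => ∑ i, u s i * inner ℝ ζ (g i s)) volume a b := by
  have h := hu.intervalIntegrable hg a b
  have h2 : IntervalIntegrable (fun s => inner ℝ ζ (∑ i, u s i • g i s)) volume a b :=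
    ⟨h.1.const_inner _, h.2.const_inner _⟩
  simpa [inner_sum, inner_smul_right] using h2

theorem inner_le_steerSupport [CompleteSpace E]
    (hg : ∀ i, Continuous (g i)) {a b : ℝ} (hab : a ≤ b) {x : E}
    (hx : x ∈ steerSet g a b) (ζ : E) : inner ℝ ζ x ≤ steerSupport g a b ζ := by
  obtain ⟨u, hu, rfl⟩ := hx
  rw [inner_integral_control hu hg]
  refine intervalIntegral.integral_mono_ae hab (hu.intervalIntegrable_inner hg a b ζ)
    ((continuous_sum_abs_inner hg ζ).intervalIntegrable a b) ?_
  filter_upwards [hu.2] with s hs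
  refine Finset.sum_le_sum fun i _ => ?_
  calc u s i * inner ℝ ζ (g i s) ≤ |u s i * inner ℝ ζ (g i s)| := le_abs_self _
    _ ≤ 1 * |inner ℝ ζ (g i s)| := by
        rw [abs_mul]; gcongr; exact abs_le.2 (hs i)
    _ = _ := one_mul _

theorem inner_extremal [CompleteSpace E] (hg : ∀ i, Continuous (g i)) (a b : ℝ) (ζ : E) :
    inner ℝ ζ (extremal g a b ζ) = steerSupport g a b ζ := by
  rw [extremal, inner_integral_control (isAdmissible_signPM hg ζ) hg]
  simp_rw [signPM_mul_self]
  rfl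

theorem steerSupport_add (hg : ∀ i, Continuous (g i)) (a b c : ℝ) (ζ : E) :
    steerSupport g a b ζ + steerSupport g b c ζ = steerSupport g a c ζ :=
  intervalIntegral.integral_add_adjacent_intervals
    ((continuous_sum_abs_inner hg ζ).intervalIntegrable _ _)
    ((continuous_sum_abs_inner hg ζ).intervalIntegrable _ _)

theorem FinitelyManySwitches.ae_ne_zero {a b : ℝ} (h : FinitelyManySwitches g a b)
    {ζ : E} (hζ : ζ ≠ 0) : ∀ᵐ s : ℝ, s ∈ Icc a b → ∀ i, inner ℝ ζ (g i s) ≠ 0 := by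
  have hfin : {s ∈ Icc a b | ∃ i, inner ℝ ζ (g i s) = 0}.Finite := by
    refine (finite_iUnion fun i => h ζ hζ i).subset fun s hs => ?_
    obtain ⟨i, hi⟩ := hs.2
    exact mem_iUnion.2 ⟨i, hs.1, hi⟩
  filter_upwards [compl_mem_ae_iff.2 (hfin.measure_zero volume)] with s hs hsI i hi
  exact hs ⟨hsI, i, hi⟩

theorem steerSupport_pos (hg : ∀ i, Continuous (g i)) {a b : ℝ} (hab : a < b) (hM : 0 < M)
    (h : FinitelyManySwitches g a b) {ζ : E} (hζ : ζ ≠ 0) : 0 < steerSupport g a b ζ := by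
  have hc := continuous_sum_abs_inner hg ζ
  have hfin := h ζ hζ ⟨0, hM⟩
  obtain ⟨s, hs, hsn⟩ := ((Icc_infinite hab).sdiff hfin).nonempty
  refine intervalIntegral.integral_pos hab hc.continuousOn
    (fun r _ => Finset.sum_nonneg fun i _ => abs_nonneg _) ⟨s, hs, ?_⟩
  refine Finset.sum_pos' (fun i _ => abs_nonneg _) ⟨⟨0, hM⟩, Finset.mem_univ _, abs_pos.2 ?_⟩
  exact fun h0 => hsn ⟨hs, h0⟩

theorem exists_bound_of_continuous {E : Type*} [NormedAddCommGroup E] {M : ℕ} {g : Fin M → ℝ → E}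
    (hg : ∀ i, Continuous (g i)) (a b : ℝ) :
    ∃ K : ℝ, 0 ≤ K ∧ ∀ s ∈ uIcc a b, ∀ i, ‖g i s‖ ≤ K := by
  have : ∀ i, ∃ K : ℝ, ∀ s ∈ uIcc a b, ‖g i s‖ ≤ K := fun i =>
    isCompact_uIcc.exists_bound_of_continuousOn (hg i).continuousOn
  choose K hK using this
  refine ⟨∑ i, |K i|, Finset.sum_nonneg fun i _ => abs_nonneg _, fun s hs i => ?_⟩
  exact ((hK i s hs).trans (le_abs_self _)).trans
    (Finset.single_le_sum (f := fun i => |K i|) (fun _ _ => abs_nonneg _) (Finset.mem_univ i))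

theorem isBounded_steerSet (hg : ∀ i, Continuous (g i)) (a b : ℝ) :
    Bornology.IsBounded (steerSet g a b) := by
  obtain ⟨K, hK0, hK⟩ := exists_bound_of_continuous hg a b
  rw [isBounded_iff_forall_norm_le]
  refine ⟨(∑ _i : Fin M, K) * |b - a|, ?_⟩
  rintro _ ⟨u, hu, rfl⟩
  refine intervalIntegral.norm_integral_le_of_norm_le_const_ae ?_
  filter_upwards [hu.2] with s hs hsI
  refine (norm_sum_le _ _).trans (Finset.sum_le_sum fun i _ => ?_)
  rw [norm_smul, ← one_mul K]
  exact mul_le_mul (abs_le.2 (hs i)) (hK s (uIoc_subset_uIcc hsI) i) (norm_nonneg _) zero_le_one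

/-- With `w = |v - signPM f|` in `[0, 2]`, the loss `|f| - v * f` equals `|f| * w`; split `w = (1 -
n|f|) w + n|f| w`. The first term matters only near the zeros of `f`. -/
theorem abs_sub_signPM_le {n v f : ℝ} (hv : |v| ≤ 1) :
    |v - signPM f| ≤ 2 * max 0 (1 - n * |f|) + n * (|f| - v * f) := by
  obtain ⟨h1, h2⟩ := abs_le.1 hv
  have key : ∀ w ∈ Icc (0 : ℝ) 2, w ≤ 2 * max 0 (1 - n * |f|) + n * (|f| * w) := by
    intro w hw
    have h3 := le_max_right 0 (1 - n * |f|)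
    have h4 := le_max_left 0 (1 - n * |f|)
    nlinarith [hw.1, hw.2]
  unfold signPM
  split_ifs with h
  · rw [abs_of_nonpos (by linarith)]
    have := key (1 - v) ⟨by linarith, by linarith⟩
    rw [abs_of_pos h] at this ⊢
    linarith
  · rw [abs_of_nonneg (by linarith)]
    have := key (v + 1) ⟨by linarith, by linarith⟩
    rw [abs_of_nonpos (not_lt.1 h)] at this ⊢
    linarith

theorem tendsto_integral_max_one_sub {f : ℝ → ℝ} (hf : Continuous f) {a b : ℝ} (hab : a ≤ b)
    (h0 : ∀ᵐ s : ℝ, s ∈ Icc a b → f s ≠ 0) :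
    Tendsto (fun n : ℕ => ∫ s in a..b, max 0 (1 - n * |f s|)) atTop (𝓝 0) := by
  have h := intervalIntegral.tendsto_integral_filter_of_dominated_convergence
    (μ := volume) (a := a) (b := b) (l := atTop) (F := fun (n : ℕ) s => max 0 (1 - n * |f s|))
    (f := fun _ => (0 : ℝ)) (fun _ => (1 : ℝ)) ?_ ?_ intervalIntegrable_const ?_
  · simpa using h
  · exact .of_forall fun n => Continuous.aestronglyMeasurable (by fun_prop)
  · refine .of_forall fun n => ae_of_all _ fun s _ => ?_
    rw [Real.norm_of_nonneg (le_max_left _ _)]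
    exact max_le zero_le_one (by have := mul_nonneg n.cast_nonneg (abs_nonneg (f s)); linarith)
  · filter_upwards [h0] with s hs hsI
    rw [uIoc_of_le hab] at hsI
    have hpos := abs_pos.2 (hs (Ioc_subset_Icc_self hsI))
    obtain ⟨n, hn⟩ := exists_nat_gt (1 / |f s|)
    refine tendsto_const_nhds.congr' ?_
    filter_upwards [eventually_ge_atTop n] with m hm
    rw [max_eq_left]
    have hm' : (n : ℝ) ≤ m := by exact_mod_cast hm
    have : 1 < n * |f s| := (div_lt_iff₀ hpos).1 hn
    nlinarith

/-- A quantitative uniqueness of the maximizer: near-optimality in direction ζ forces closeness to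
`extremal`. As a closed condition on `x`, it survives passage to the closure. -/
theorem exists_norm_sub_extremal_le [CompleteSpace E]
    (hg : ∀ i, Continuous (g i)) {a b : ℝ} (hab : a ≤ b)
    (h : FinitelyManySwitches g a b) {ζ : E} (hζ : ζ ≠ 0) {ε : ℝ} (hε : 0 < ε) :
    ∃ C : ℝ, ∀ x ∈ steerSet g a b,
      ‖x - extremal g a b ζ‖ ≤ ε + C * (steerSupport g a b ζ - inner ℝ ζ x) := by
  obtain ⟨K, hK0, hK⟩ := exists_bound_of_continuous hg a b
  have hfc : ∀ i, Continuous fun s => inner ℝ ζ (g i s) := fun i => continuous_const.inner (hg i)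
  have hlim : Tendsto (fun n : ℕ => ∑ i, K * (2 * ∫ s in a..b, max 0 (1 - n * |inner ℝ ζ (g i s)|)))
      atTop (𝓝 0) := by
    have : Tendsto (fun n : ℕ => ∑ i, K * (2 * ∫ s in a..b, max 0 (1 - n * |inner ℝ ζ (g i s)|)))
      atTop (𝓝 (∑ _i : Fin M, K * (2 * 0))) := by
      refine tendsto_finsetSum _ fun i _ => ?_
      refine ((tendsto_integral_max_one_sub (hfc i) hab ?_).const_mul 2).const_mul K
      filter_upwards [h.ae_ne_zero hζ] with s hs hsI using hs hsI i
    simpa using this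
  obtain ⟨n, hn⟩ := (hlim.eventually (gt_mem_nhds hε)).exists
  -- `n` was chosen so that the contribution of times near the zeros of `⟨ζ, g i⟩` is below ε;
  -- elsewhere the loss of optimality is multiplied by `n`, and `K` bounds the `g i`.
  refine ⟨K * n, ?_⟩
  rintro _ ⟨u, hu, rfl⟩
  have hφc : ∀ i, Continuous fun s => max 0 (1 - n * |inner ℝ ζ (g i s)|) := fun i => by
    have := hfc i
    fun_prop
  have hint0 : ∀ i, IntervalIntegrable
      (fun s => K * (2 * max 0 (1 - n * |inner ℝ ζ (g i s)|))) volume a b := fun i =>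
    (continuous_const.mul (continuous_const.mul (hφc i))).intervalIntegrable _ _
  have hint1 : IntervalIntegrable
      (fun s => ∑ i, K * (2 * max 0 (1 - n * |inner ℝ ζ (g i s)|))) volume a b :=
    (continuous_finsetSum _ fun i _ => continuous_const.mul
      (continuous_const.mul (hφc i))).intervalIntegrable _ _
  have hint2 : IntervalIntegrable (fun s => (∑ i, |inner ℝ ζ (g i s)|) -
      ∑ i, u s i * inner ℝ ζ (g i s)) volume a b :=
    ((continuous_sum_abs_inner hg ζ).intervalIntegrable _ _).sub
      (hu.intervalIntegrable_inner hg a b ζ)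
  rw [extremal, ← intervalIntegral.integral_sub (hu.intervalIntegrable hg a b)
    ((isAdmissible_signPM hg ζ).intervalIntegrable hg a b)]
  have hle : ‖∫ s in a..b, (∑ i, u s i • g i s) - ∑ i, signPM (inner ℝ ζ (g i s)) • g i s‖ ≤
      ∫ s in a..b, (∑ i, K * (2 * max 0 (1 - n * |inner ℝ ζ (g i s)|))) +
        K * n * ((∑ i, |inner ℝ ζ (g i s)|) - ∑ i, u s i * inner ℝ ζ (g i s)) := by
    refine intervalIntegral.norm_integral_le_of_norm_le hab ?_ (hint1.add (hint2.const_mul _))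
    filter_upwards [hu.2] with s hs hsI
    rw [← Finset.sum_sub_distrib, ← Finset.sum_sub_distrib, Finset.mul_sum,
      ← Finset.sum_add_distrib]
    refine (norm_sum_le _ _).trans (Finset.sum_le_sum fun i _ => ?_)
    rw [← sub_smul, norm_smul, Real.norm_eq_abs]
    have h1 := abs_sub_signPM_le (n := n) (f := inner ℝ ζ (g i s)) (abs_le.2 (hs i))
    have h2 := hK s (uIoc_subset_uIcc (uIoc_of_le hab ▸ hsI)) i
    calc _ ≤ |u s i - signPM (inner ℝ ζ (g i s))| * K := by gcongr
      _ ≤ (2 * max 0 (1 - n * |inner ℝ ζ (g i s)|) +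
          n * (|inner ℝ ζ (g i s)| - u s i * inner ℝ ζ (g i s))) * K := by gcongr
      _ = _ := by ring
  refine hle.trans ?_
  rw [intervalIntegral.integral_add hint1 (hint2.const_mul _),
    intervalIntegral.integral_const_mul, intervalIntegral.integral_sub
      ((continuous_sum_abs_inner hg ζ).intervalIntegrable _ _)
      (hu.intervalIntegrable_inner hg a b ζ), inner_integral_control hu hg,
    intervalIntegral.integral_finsetSum fun i _ => hint0 i]
  simp_rw [intervalIntegral.integral_const_mul]
  exact add_le_add hn.le le_rfl

theorem eq_extremal_of_mem_closure [CompleteSpace E]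
    (hg : ∀ i, Continuous (g i)) {a b : ℝ} (hab : a ≤ b)
    (h : FinitelyManySwitches g a b) {ζ : E} (hζ : ζ ≠ 0) {x : E}
    (hx : x ∈ closure (steerSet g a b)) (hxζ : steerSupport g a b ζ ≤ inner ℝ ζ x) :
    x = extremal g a b ζ := by
  have hcl : closure (steerSet g a b) ⊆ {z | inner ℝ ζ z ≤ steerSupport g a b ζ} :=
    closure_minimal (fun z hz => inner_le_steerSupport hg hab hz ζ)
      (isClosed_le (by fun_prop) continuous_const)
  have heq : inner ℝ ζ x = steerSupport g a b ζ := le_antisymm (hcl hx) hxζ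
  rw [← sub_eq_zero, ← norm_le_zero_iff]
  refine le_of_forall_pos_le_add fun ε hε => ?_
  obtain ⟨C, hC⟩ := exists_norm_sub_extremal_le hg hab h hζ hε
  have hcl2 : closure (steerSet g a b) ⊆
      {z | ‖z - extremal g a b ζ‖ ≤ ε + C * (steerSupport g a b ζ - inner ℝ ζ z)} :=
    closure_minimal hC (isClosed_le (by fun_prop) (by fun_prop))
  have := hcl2 hx
  simp only [mem_ofPred_eq, heq] at this
  linarith

end SteerSet

/-! ### Interior and closedness of the set of control integrals. -/

section SteerSetInterior

variable {E : Type*} [NormedAddCommGroup E] [InnerProductSpace ℝ E] [FiniteDimensional ℝ E]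
variable {M : ℕ} {g : Fin M → ℝ → E}

theorem zero_mem_interior_steerSet (hg : ∀ i, Continuous (g i)) (hM : 0 < M) {a b : ℝ}
    (hab : a < b) (h : FinitelyManySwitches g a b) : (0 : E) ∈ interior (steerSet g a b) := by
  refine zero_mem_interior_of_symmetric (convex_steerSet hg a b) (zero_mem_steerSet g a b)
    (fun x => neg_mem_steerSet) fun ζ hζ => ⟨_, extremal_mem_steerSet hg a b ζ, ?_⟩
  rw [inner_extremal hg]
  exact (steerSupport_pos hg hab hM h hζ).ne'

theorem exists_unit_normal_steerSet (hg : ∀ i, Continuous (g i)) (hM : 0 < M) {a b : ℝ}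
    (hab : a < b) (h : FinitelyManySwitches g a b) {x : E} (hx : x ∉ interior (steerSet g a b)) :
    ∃ ζ : E, ‖ζ‖ = 1 ∧ steerSupport g a b ζ ≤ inner ℝ ζ x := by
  obtain ⟨ζ, hζ, hz⟩ := exists_unit_normal_of_notMem_interior (convex_steerSet hg a b)
    ⟨0, zero_mem_interior_steerSet hg hM hab h⟩ hx
  refine ⟨ζ, hζ, ?_⟩
  rw [← inner_extremal hg]
  exact hz _ (subset_closure (extremal_mem_steerSet hg a b ζ))

/-- A limit point outside the interior has a supporting normal, hence is the extremal point of that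
normal, which is attained. No weak compactness of controls is involved. -/
theorem isClosed_steerSet (hg : ∀ i, Continuous (g i)) (hM : 0 < M) {a b : ℝ}
    (hab : a < b) (h : FinitelyManySwitches g a b) : IsClosed (steerSet g a b) := by
  refine isClosed_of_closure_subset fun x hx => ?_
  by_cases hxi : x ∈ interior (steerSet g a b)
  · exact interior_subset hxi
  obtain ⟨ζ, hζ, hz⟩ := exists_unit_normal_steerSet hg hM hab h hxi
  rw [eq_extremal_of_mem_closure hg hab.le h (norm_ne_zero_iff.1 (by simp [hζ])) hx hz]
  exact extremal_mem_steerSet hg a b ζ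

/-- The additional time from `b` to `c` contributes a whole neighborhood of zero. -/
theorem steerSet_subset_interior (hg : ∀ i, Continuous (g i)) (hM : 0 < M) {a b c : ℝ}
    (hab : a ≤ b) (hbc : b < c) (h : FinitelyManySwitches g b c) :
    steerSet g a b ⊆ interior (steerSet g a c) := by
  intro x hx
  have h0 := zero_mem_interior_steerSet hg hM hbc h
  have hopen : IsOpen ((fun z => z - x) ⁻¹' interior (steerSet g b c)) :=
    isOpen_interior.preimage (continuous_id.sub continuous_const)
  refine interior_maximal (fun z hz => ?_) hopen (by simpa using h0)
  have := add_mem_steerSet hg hab hbc.le hx (interior_subset hz)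
  simpa using this

end SteerSetInterior

/-! ### Minimum time, and its failure to be Lipschitz in terms of normals. -/

theorem nonLipschitzAt_iff {E : Type*} [NormedAddCommGroup E] {f : E → ℝ} {x : E} :
    NonLipschitzAt f x ↔ ∀ K : ℝ, ∀ U ∈ 𝓝 x, ∃ p ∈ U, ∃ q ∈ U, K * ‖q - p‖ < |f q - f p| := by
  constructor
  · rintro ⟨p, q, hne, hp, hq, hlim⟩ K U hU
    have hfr := frequently_lt_of_lt_limsup (b := (K : EReal)) (by isBoundedDefault)
      (hlim ▸ EReal.coe_lt_top K)
    obtain ⟨i, hi, hpi, hqi⟩ :=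
      (hfr.and_eventually ((hp.eventually hU).and (hq.eventually hU))).exists
    refine ⟨p i, hpi, q i, hqi, ?_⟩
    have hpos : 0 < ‖q i - p i‖ := norm_pos_iff.2 (sub_ne_zero.2 (hne i).symm)
    exact (lt_div_iff₀ hpos).1 (EReal.coe_lt_coe_iff.1 hi)
  · intro h
    have : ∀ n : ℕ, ∃ p q : E, p ∈ Metric.ball x (1 / ((n : ℝ) + 1)) ∧
        q ∈ Metric.ball x (1 / ((n : ℝ) + 1)) ∧ n * ‖q - p‖ < |f q - f p| := fun n => by
      obtain ⟨p, hp, q, hq, hpq⟩ := h n _ (Metric.ball_mem_nhds x (ε := 1 / ((n : ℝ) + 1))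
        (by positivity))
      exact ⟨p, q, hp, hq, hpq⟩
    choose p q hp hq hpq using this
    -- For equal points both sides of the strict inequality would vanish.
    have hne : ∀ i, p i ≠ q i := fun i hi => by simpa [hi] using hpq i
    have hball : ∀ r : ℕ → E, (∀ n : ℕ, r n ∈ Metric.ball x (1 / ((n : ℝ) + 1))) →
        Tendsto r atTop (𝓝 x) := fun r hr =>
      tendsto_iff_dist_tendsto_zero.2 (squeeze_zero (fun _ => dist_nonneg)
        (fun n => (Metric.mem_ball.1 (hr n)).le) tendsto_one_div_add_atTop_nhds_zero_nat)
    refine ⟨p, q, hne, hball p hp, hball q hq, Tendsto.limsup_eq ?_⟩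
    rw [EReal.tendsto_coe_nhds_top_iff]
    refine tendsto_atTop_mono (fun n => ?_) tendsto_natCast_atTop_atTop
    have hpos : 0 < ‖q n - p n‖ := norm_pos_iff.2 (sub_ne_zero.2 (hne n).symm)
    exact ((lt_div_iff₀ hpos).2 (hpq n)).le

variable {N M : ℕ} {A : Matrix (Fin N) (Fin N) ℝ} {B : Matrix (Fin N) (Fin M) ℝ}

theorem continuous_columnFlow (A : Matrix (Fin N) (Fin N) ℝ) (B : Matrix (Fin N) (Fin M) ℝ)
    (i : Fin M) : Continuous (columnFlow A B i) := (contDiff_columnFlow A B i).continuous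

theorem steersAt_iff_mem_steerSet {x : EuclideanSpace ℝ (Fin N)} {t : ℝ} (ht : 0 ≤ t) :
    SteersAt A B x t ↔ x ∈ steerSet (columnFlow A B) 0 t := steersAt_iff A B x ht

theorem reachSet_eq_steerSet {τ : ℝ} (hτ : 0 ≤ τ) :
    reachSet A B τ = steerSet (columnFlow A B) 0 τ := by
  ext x
  constructor
  · rintro ⟨t, ht, hx⟩
    exact steerSet_mono (continuous_columnFlow A B) ht.1 ht.2
      ((steersAt_iff_mem_steerSet ht.1).1 hx)
  · exact fun hx => ⟨τ, ⟨hτ, le_rfl⟩, (steersAt_iff_mem_steerSet hτ).2 hx⟩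

theorem minTime_le_of_mem_steerSet {x : EuclideanSpace ℝ (Fin N)} {t : ℝ} (ht : 0 ≤ t)
    (hx : x ∈ steerSet (columnFlow A B) 0 t) : minTime A B x ≤ ENNReal.ofReal t :=
  iInf_le_of_le t (iInf_le_of_le ht (iInf_le_of_le ((steersAt_iff_mem_steerSet ht).2 hx) le_rfl))

theorem mem_steerSet_of_minTime_lt {x : EuclideanSpace ℝ (Fin N)} {t : ℝ}
    (hx : minTime A B x < ENNReal.ofReal t) : x ∈ steerSet (columnFlow A B) 0 t := by
  simp only [minTime, iInf_lt_iff] at hx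
  obtain ⟨s, hs, hxs, hst⟩ := hx
  have hst' : s < t := (ENNReal.ofReal_lt_ofReal_iff_of_nonneg hs).1 hst
  exact steerSet_mono (continuous_columnFlow A B) hs hst'.le ((steersAt_iff_mem_steerSet hs).1 hxs)

theorem continuous_steerSupport {E : Type*} [NormedAddCommGroup E] [InnerProductSpace ℝ E]
    {g : Fin M → ℝ → E} (hg : ∀ i, Continuous (g i)) (a : ℝ) :
    Continuous fun p : ℝ × E => steerSupport g a p.1 p.2 := by
  refine intervalIntegral.continuous_parametric_intervalIntegral_of_continuous
    (f := fun (p : ℝ × E) s => ∑ i, |inner ℝ p.2 (g i s)|) ?_ continuous_fst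
  refine continuous_finsetSum _ fun i _ => ?_
  have := hg i
  fun_prop

/-- A point of the reachable set at which some normal annihilates `e^{-τA} B` is a point of the
boundary at which the minimum time function is non-Lipschitz. -/
theorem mem_nonLipFront_of_normal {T τ : ℝ} (hM : 0 < M)
    (h : FinitelyManySwitches (columnFlow A B) 0 T) (hτ : 0 < τ) (hτT : τ < T)
    {x ζ : EuclideanSpace ℝ (Fin N)} (hx : x ∈ steerSet (columnFlow A B) 0 τ) (hζ : ‖ζ‖ = 1)
    (hV : ∀ i, inner ℝ ζ (columnFlow A B i τ) = 0)
    (hsupp : steerSupport (columnFlow A B) 0 τ ζ ≤ inner ℝ ζ x) : x ∈ nonLipFront A B τ := by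
  have hg := continuous_columnFlow A B
  have hfin : ∀ᶠ z in 𝓝 x, minTime A B z ≠ ⊤ := by
    filter_upwards [mem_interior_iff_mem_nhds.1 (steerSet_subset_interior hg hM hτ.le hτT
      (h.mono hτ.le le_rfl) hx)] with z hz
    exact ne_top_of_le_ne_top ENNReal.ofReal_ne_top
      (minTime_le_of_mem_steerSet (hτ.le.trans hτT.le) hz)
  have hinner : ∀ δ : ℝ, inner ℝ ζ (x + δ • ζ) = inner ℝ ζ x + δ := fun δ => by
    simp [inner_add_right, inner_smul_right, hζ]
  have hpath : Tendsto (fun δ : ℝ => x + δ • ζ) (𝓝[>] 0) (𝓝 x) := by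
    have : Continuous fun δ : ℝ => x + δ • ζ := by fun_prop
    simpa using (this.tendsto 0).mono_left nhdsWithin_le_nhds
  refine ⟨⟨hfin.self_of_nhds, nonLipschitzAt_iff.2 fun K U hU => ?_⟩, ?_⟩
  -- Any rate exceeding `K` would do: along ζ the minimum time will be shown to grow at least at
  -- rate `L`.
  · set L := |K| + 1 with hL
    have hLpos : 0 < L := by positivity
    -- Since the support function is stationary at τ, the level `inner ℝ ζ x + δ` is still not
    -- attained at time `τ + L * δ` for small `δ`, so `x + δ • ζ` is not reachable by then.
    have hder : HasDerivAt (fun t => steerSupport (columnFlow A B) 0 t ζ) 0 τ := by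
      have := intervalIntegral.integral_hasDerivAt_right (a := 0) (b := τ)
        ((continuous_sum_abs_inner hg ζ).intervalIntegrable _ _)
        ((continuous_sum_abs_inner hg ζ).stronglyMeasurableAtFilter _ _)
        (continuous_sum_abs_inner hg ζ).continuousAt
      refine this.congr_deriv ?_
      simp [hV]
    have hsmall : ∀ᶠ δ : ℝ in 𝓝[>] 0, steerSupport (columnFlow A B) 0 (τ + L * δ) ζ <
        steerSupport (columnFlow A B) 0 τ ζ + δ := by
      have hd : HasDerivAt (fun δ : ℝ => steerSupport (columnFlow A B) 0 (τ + L * δ) ζ) 0 0 := by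
        have h1 : HasDerivAt (fun δ : ℝ => τ + L * δ) L 0 := by
          simpa using ((hasDerivAt_id (0 : ℝ)).const_mul L).const_add τ
        have h2 : HasDerivAt (fun t => steerSupport (columnFlow A B) 0 t ζ) 0 (τ + L * 0) := by
          simpa using hder
        simpa using! h2.comp (0 : ℝ) h1
      have := (hasDerivAt_iff_tendsto_slope.1 hd).mono_left
        (nhdsWithin_mono 0 fun y (hy : y ∈ Ioi (0 : ℝ)) => (ne_of_gt hy))
      filter_upwards [this.eventually (gt_mem_nhds zero_lt_one), self_mem_nhdsWithin] with δ h1 h2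
      rw [slope_def_field, sub_zero, div_lt_one h2] at h1
      simp only [mul_zero, add_zero] at h1
      linarith
    obtain ⟨δ, hδ1, hδ2, hδ3, hδ0⟩ := (hsmall.and ((hpath.eventually hU).and
      ((hpath.eventually hfin).and self_mem_nhdsWithin))).exists
    have hδpos : 0 < δ := hδ0
    have hlow : ENNReal.ofReal (τ + L * δ) ≤ minTime A B (x + δ • ζ) := by
      by_contra hlt
      have h1 := inner_le_steerSupport hg (by positivity)
        (mem_steerSet_of_minTime_lt (not_le.1 hlt)) ζ
      rw [hinner] at h1
      linarith
    have h1 : τ + L * δ ≤ (minTime A B (x + δ • ζ)).toReal :=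
      (ENNReal.ofReal_le_iff_le_toReal hδ3).1 hlow
    have h2 : (minTime A B x).toReal ≤ τ :=
      ENNReal.toReal_le_of_le_ofReal hτ.le (minTime_le_of_mem_steerSet hτ.le hx)
    refine ⟨x, mem_of_mem_nhds hU, x + δ • ζ, hδ2, ?_⟩
    rw [add_sub_cancel_left, norm_smul, hζ, mul_one, Real.norm_of_nonneg hδpos.le]
    refine lt_of_lt_of_le ?_ (le_abs_self _)
    have := le_abs_self K
    nlinarith
  · rw [reachSet_eq_steerSet hτ.le]
    refine ⟨subset_closure hx, fun hint => ?_⟩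
    obtain ⟨δ, hδ, hδ0⟩ := ((hpath.eventually (mem_interior_iff_mem_nhds.1 hint)).and
      self_mem_nhdsWithin).exists
    have h1 := inner_le_steerSupport hg hτ.le hδ ζ
    rw [hinner] at h1
    have : 0 < δ := hδ0
    linarith

/-- If the minimum time increases from `p` to `q` at a rate above `K`, then some normal at `q` to
a nearby reachable set is almost orthogonal to the controlled directions. -/
theorem exists_normal_of_steep (hM : 0 < M) {T K c d : ℝ} (hK : 0 < K) (hc : 0 < c) (hd : d ≤ T)
    (h : FinitelyManySwitches (columnFlow A B) 0 T) {p q : EuclideanSpace ℝ (Fin N)}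
    (hp : minTime A B p ∈ Icc (ENNReal.ofReal c) (ENNReal.ofReal d))
    (hq : minTime A B q ∈ Icc (ENNReal.ofReal c) (ENNReal.ofReal d))
    (hpq : K * ‖q - p‖ < (minTime A B q).toReal - (minTime A B p).toReal) :
    ∃ ζ : EuclideanSpace ℝ (Fin N), ∃ s ∈ Icc c d, ∃ b ∈ Icc c d, ‖ζ‖ = 1 ∧
      ∑ i, |inner ℝ ζ (columnFlow A B i s)| ≤ 1 / K ∧
      steerSupport (columnFlow A B) 0 b ζ ≤ inner ℝ ζ q := by
  have hg := continuous_columnFlow A B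
  have hpt : minTime A B p ≠ ⊤ := ne_top_of_le_ne_top ENNReal.ofReal_ne_top hp.2
  have hqt : minTime A B q ≠ ⊤ := ne_top_of_le_ne_top ENNReal.ofReal_ne_top hq.2
  have hpc : c ≤ (minTime A B p).toReal := (ENNReal.ofReal_le_iff_le_toReal hpt).1 hp.1
  have hqd : (minTime A B q).toReal ≤ d := by
    have hd0 : 0 < d := by
      have := ENNReal.ofReal_pos.2 hc
      exact ENNReal.ofReal_pos.1 (this.trans_le (hp.1.trans hp.2))
    exact ENNReal.toReal_le_of_le_ofReal hd0.le hq.2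
  set P := (minTime A B p).toReal with hP
  set Q := (minTime A B q).toReal with hQ
  -- A third of the slack: `p` is reachable at time `P + r`, `q` is not at `Q - r`, and these times
  -- are still more than `K * ‖q - p‖` apart.
  set r := (Q - P - K * ‖q - p‖) / 3 with hr
  have hKn : 0 ≤ K * ‖q - p‖ := by positivity
  have hr0 : 0 < r := by rw [hr]; linarith
  have hab : P + r < Q - r := by rw [hr]; linarith
  have hpa : p ∈ steerSet (columnFlow A B) 0 (P + r) := by
    refine mem_steerSet_of_minTime_lt ?_
    rw [← ENNReal.ofReal_toReal hpt]
    exact (ENNReal.ofReal_lt_ofReal_iff (by linarith)).2 (by linarith)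
  have hqb : q ∉ interior (steerSet (columnFlow A B) 0 (Q - r)) := by
    intro hmem
    have := minTime_le_of_mem_steerSet (by linarith) (interior_subset hmem)
    have := ENNReal.toReal_le_of_le_ofReal (by linarith) this
    linarith
  obtain ⟨ζ, hζ, hsupp⟩ := exists_unit_normal_steerSet hg hM (by linarith)
    (h.mono le_rfl (by linarith)) hqb
  have hpa' := inner_le_steerSupport hg (by linarith) hpa ζ
  have hadd := steerSupport_add hg 0 (P + r) (Q - r) ζ
  have hdiff : steerSupport (columnFlow A B) (P + r) (Q - r) ζ ≤ ‖q - p‖ := by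
    have h1 := real_inner_le_norm ζ (q - p)
    rw [hζ, one_mul, inner_sub_right] at h1
    linarith
  -- Mean value argument: an integral of at most `‖q - p‖` over an interval longer than `K * ‖q -
  -- p‖` has an integrand that is somewhere at most `1 / K`.
  have hex : ∃ s ∈ Icc (P + r) (Q - r), ∑ i, |inner ℝ ζ (columnFlow A B i s)| ≤ 1 / K := by
    by_contra! hcon
    have h1 : ∫ _s in (P + r)..(Q - r), 1 / K ≤
        steerSupport (columnFlow A B) (P + r) (Q - r) ζ :=
      intervalIntegral.integral_mono_on hab.le intervalIntegrable_const
        ((continuous_sum_abs_inner hg ζ).intervalIntegrable _ _) fun s hs => (hcon s hs).le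
    rw [intervalIntegral.integral_const, smul_eq_mul] at h1
    have h2 := h1.trans hdiff
    rw [mul_one_div, div_le_iff₀ hK] at h2
    have : ‖q - p‖ * K = K * ‖q - p‖ := mul_comm _ _
    linarith
  obtain ⟨s, hs, hsK⟩ := hex
  exact ⟨ζ, s, ⟨by linarith [hs.1], by linarith [hs.2]⟩, Q - r, ⟨by linarith, by linarith⟩, hζ,
    hsK, hsupp⟩

/-- Every point of the non-Lipschitz front has a unit normal orthogonal to `e^{-τA} B`. -/
theorem exists_normal_of_mem_nonLipFront {T τ : ℝ} (hM : 0 < M)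
    (h : FinitelyManySwitches (columnFlow A B) 0 T) (hτ : 0 < τ) (hτT : τ < T)
    {x : EuclideanSpace ℝ (Fin N)} (hx : x ∈ nonLipFront A B τ) :
    ∃ ζ : EuclideanSpace ℝ (Fin N), ‖ζ‖ = 1 ∧ (∀ i, inner ℝ ζ (columnFlow A B i τ) = 0) ∧
      x = extremal (columnFlow A B) 0 τ ζ := by
  have hg := continuous_columnFlow A B
  obtain ⟨⟨-, hnl⟩, hfr⟩ := hx
  rw [reachSet_eq_steerSet hτ.le] at hfr
  have hcl := isClosed_steerSet hg hM hτ (h.mono le_rfl hτT.le)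
  have hxs : x ∈ steerSet (columnFlow A B) 0 τ := hcl.frontier_subset hfr
  -- The minimum time is continuous at `x` with value τ: later reachable sets contain `x` in their
  -- interior, while earlier ones are closed and miss it.
  have hloc : ∀ ε : ℝ, 0 < ε → ε < τ → τ + ε ≤ T → ∀ᶠ z in 𝓝 x,
      minTime A B z ∈ Icc (ENNReal.ofReal (τ - ε)) (ENNReal.ofReal (τ + ε)) := by
    intro ε hε hετ hεT
    have h1 := mem_interior_iff_mem_nhds.1 (steerSet_subset_interior hg hM hτ.le
      (lt_add_of_pos_right τ hε) (h.mono hτ.le hεT) hxs)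
    have h2 : x ∉ steerSet (columnFlow A B) 0 (τ - ε) := fun hmem =>
      hfr.2 (steerSet_subset_interior hg hM (by linarith) (by linarith)
        (h.mono (by linarith) hτT.le) hmem)
    have h3 := (isClosed_steerSet hg hM (show 0 < τ - ε by linarith)
      (h.mono le_rfl (by linarith))).isOpen_compl.mem_nhds h2
    filter_upwards [h1, h3] with z hz1 hz3
    refine ⟨?_, minTime_le_of_mem_steerSet (by linarith) hz1⟩
    by_contra hlt
    exact hz3 (mem_steerSet_of_minTime_lt (not_le.1 hlt))
  obtain ⟨ε₀, hε₀, hε₀τ, hε₀T⟩ : ∃ ε₀ : ℝ, 0 < ε₀ ∧ ε₀ < τ ∧ τ + ε₀ ≤ T :=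
    ⟨min (τ / 2) ((T - τ) / 2), lt_min (by linarith) (by linarith),
      (min_le_left _ _).trans_lt (by linarith),
      by linarith [min_le_right (τ / 2) ((T - τ) / 2)]⟩
  have hstep : ∀ n : ℕ, ∃ (ζ q : EuclideanSpace ℝ (Fin N)) (s b : ℝ), ‖ζ‖ = 1 ∧
      ‖q - x‖ ≤ 1 / ((n : ℝ) + 1) ∧ |s - τ| ≤ 1 / ((n : ℝ) + 1) ∧ |b - τ| ≤ 1 / ((n : ℝ) + 1) ∧
      ∑ i, |inner ℝ ζ (columnFlow A B i s)| ≤ 1 / ((n : ℝ) + 1) ∧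
      steerSupport (columnFlow A B) 0 b ζ ≤ inner ℝ ζ q := by
    intro n
    have hn : (0 : ℝ) < 1 / ((n : ℝ) + 1) := by positivity
    set ε := min ε₀ (1 / ((n : ℝ) + 1)) with hε
    have hεpos : 0 < ε := lt_min hε₀ hn
    have hεε₀ : ε ≤ ε₀ := min_le_left _ _
    have hεn : ε ≤ 1 / ((n : ℝ) + 1) := min_le_right _ _
    have hU := (hloc ε hεpos (by linarith) (by linarith)).and
      (Metric.closedBall_mem_nhds x hn)
    obtain ⟨p, hp, q, hq, hpq⟩ := nonLipschitzAt_iff.1 hnl ((n : ℝ) + 1) _ hU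
    have main : ∀ p q : EuclideanSpace ℝ (Fin N),
        (minTime A B p ∈ Icc (ENNReal.ofReal (τ - ε)) (ENNReal.ofReal (τ + ε)) ∧
          p ∈ Metric.closedBall x (1 / ((n : ℝ) + 1))) →
        (minTime A B q ∈ Icc (ENNReal.ofReal (τ - ε)) (ENNReal.ofReal (τ + ε)) ∧
          q ∈ Metric.closedBall x (1 / ((n : ℝ) + 1))) →
        ((n : ℝ) + 1) * ‖q - p‖ < (minTime A B q).toReal - (minTime A B p).toReal →
        ∃ (ζ q : EuclideanSpace ℝ (Fin N)) (s b : ℝ), ‖ζ‖ = 1 ∧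
          ‖q - x‖ ≤ 1 / ((n : ℝ) + 1) ∧ |s - τ| ≤ 1 / ((n : ℝ) + 1) ∧
          |b - τ| ≤ 1 / ((n : ℝ) + 1) ∧
          ∑ i, |inner ℝ ζ (columnFlow A B i s)| ≤ 1 / ((n : ℝ) + 1) ∧
          steerSupport (columnFlow A B) 0 b ζ ≤ inner ℝ ζ q := by
      intro p q hp hq hpq
      obtain ⟨ζ, s, hs, b, hb, hζ, hsum, hsupp⟩ := exists_normal_of_steep hM
        (show (0 : ℝ) < (n : ℝ) + 1 by positivity) (show 0 < τ - ε by linarith)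
        (show τ + ε ≤ T by linarith) h hp.1 hq.1 hpq
      refine ⟨ζ, q, s, b, hζ, mem_closedBall_iff_norm.1 hq.2, ?_, ?_, hsum, hsupp⟩
      · exact abs_le.2 ⟨by linarith [hs.1], by linarith [hs.2]⟩
      · exact abs_le.2 ⟨by linarith [hb.1], by linarith [hb.2]⟩
    -- Name `q` whichever of the two points has the larger minimum time.
    rcases lt_abs.1 hpq with hlt | hlt
    · exact main p q hp hq hlt
    · refine main q p hq hp ?_
      rw [norm_sub_rev]
      linarith
  choose ζ q s b hζ hq hs hb hsum hsupp using hstep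
  -- Compactness of the sphere gives a limiting normal; the rate bound tends to zero and the support
  -- inequality passes to the limit.
  obtain ⟨ζ₀, hζ₀, φ, hφ, hlim⟩ :=
    (isCompact_sphere (0 : EuclideanSpace ℝ (Fin N)) 1).tendsto_subseq (x := ζ) (fun n => by simp [hζ n])
  have hone : Tendsto (fun n => 1 / ((φ n : ℝ) + 1)) atTop (𝓝 0) :=
    tendsto_one_div_add_atTop_nhds_zero_nat.comp hφ.tendsto_atTop
  have hqlim : Tendsto (q ∘ φ) atTop (𝓝 x) :=
    tendsto_iff_norm_sub_tendsto_zero.2 (squeeze_zero (fun _ => norm_nonneg _)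
      (fun n => hq (φ n)) hone)
  have hslim : Tendsto (s ∘ φ) atTop (𝓝 τ) :=
    tendsto_iff_norm_sub_tendsto_zero.2 (squeeze_zero (fun _ => norm_nonneg _)
      (fun n => hs (φ n)) hone)
  have hblim : Tendsto (b ∘ φ) atTop (𝓝 τ) :=
    tendsto_iff_norm_sub_tendsto_zero.2 (squeeze_zero (fun _ => norm_nonneg _)
      (fun n => hb (φ n)) hone)
  have hζ₀' : ‖ζ₀‖ = 1 := by simpa using hζ₀
  have hsum0 : ∑ i, |inner ℝ ζ₀ (columnFlow A B i τ)| ≤ 0 := by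
    have hc : Continuous fun p : EuclideanSpace ℝ (Fin N) × ℝ =>
        ∑ i, |inner ℝ p.1 (columnFlow A B i p.2)| := by
      refine continuous_finsetSum _ fun i _ => ?_
      have := hg i
      fun_prop
    exact le_of_tendsto_of_tendsto' ((hc.tendsto (ζ₀, τ)).comp (hlim.prodMk_nhds hslim)) hone
      fun n => hsum (φ n)
  have hsupp0 : steerSupport (columnFlow A B) 0 τ ζ₀ ≤ inner ℝ ζ₀ x :=
    le_of_tendsto_of_tendsto' (((continuous_steerSupport hg 0).tendsto (τ, ζ₀)).comp
      (hblim.prodMk_nhds hlim)) (hlim.inner hqlim) fun n => hsupp (φ n)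
  refine ⟨ζ₀, hζ₀', fun i => ?_, ?_⟩
  · have := (Finset.sum_eq_zero_iff_of_nonneg fun i _ => abs_nonneg _).1
      (le_antisymm hsum0 (Finset.sum_nonneg fun i _ => abs_nonneg _)) i (Finset.mem_univ i)
    exact abs_eq_zero.1 this
  · exact eq_extremal_of_mem_closure hg hτ.le (h.mono le_rfl hτT.le)
      (norm_ne_zero_iff.1 (by simp [hζ₀'])) (subset_closure hxs) hsupp0

/-! ### Positive Hausdorff measure of the front. -/

theorem image_interior_subset_image_frontier {F G : Type*} [NormedAddCommGroup F]
    [NormedSpace ℝ F] [AddCommGroup G] [Module ℝ G] (π : F →ₗ[ℝ] G) {w : F} (hw : w ≠ 0)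
    (hπw : π w = 0) {K : Set F} (hK : Bornology.IsBounded K) : π '' K ⊆ π '' frontier K := by
  rintro _ ⟨k, hk, rfl⟩
  have hc : Continuous fun t : ℝ => k + t • w := by fun_prop
  -- The line through `k` in a kernel direction stays in one fiber of `π` and must leave the bounded
  -- set, so it meets the frontier.
  have hne : (frontier ((fun t : ℝ => k + t • w) ⁻¹' K)).Nonempty := by
    refine nonempty_frontier_iff.2 ⟨⟨0, by simpa using hk⟩, fun huniv => ?_⟩
    obtain ⟨C, hC⟩ := hK.exists_norm_le
    have hw' : 0 < ‖w‖ := norm_pos_iff.2 hw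
    have hmem : (‖k‖ + |C| + 1) / ‖w‖ ∈ (fun t : ℝ => k + t • w) ⁻¹' K := huniv ▸ mem_univ _
    have h1 := hC _ hmem
    have h2 := norm_sub_norm_le (((‖k‖ + |C| + 1) / ‖w‖) • w) (-k)
    rw [sub_neg_eq_add, add_comm _ k, norm_smul, norm_neg, Real.norm_of_nonneg (by positivity),
      div_mul_cancel₀ _ hw'.ne'] at h2
    have := le_abs_self C
    simp only at h1
    linarith
  obtain ⟨t, ht⟩ := hne
  exact ⟨k + t • w, hc.frontier_preimage_subset K ht, by simp [hπw]⟩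

/-- A Lipschitz map cannot send an `H^d`-null set onto a set of positive measure, and on `Fin d → ℝ`
with the sup norm `H^d` is Lebesgue measure. -/
theorem hausdorffMeasure_pos_of_isOpen_subset_image {E : Type*} [NormedAddCommGroup E]
    [NormedSpace ℝ E] [MeasurableSpace E] [BorelSpace E] {d : ℕ} (R : E →L[ℝ] (Fin d → ℝ))
    {S : Set E} {U : Set (Fin d → ℝ)} (hU : IsOpen U) (hne : U.Nonempty) (hUS : U ⊆ R '' S) :
    0 < (μH[(d : ℝ)] : Measure E) S := by
  refine pos_iff_ne_zero.2 fun h0 => (hU.measure_pos volume hne).ne' ?_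
  have hvol : (μH[(d : ℝ)] : Measure (Fin d → ℝ)) = volume := by
    simpa using hausdorffMeasure_pi_real (ι := Fin d)
  have h1 := R.lipschitz.hausdorffMeasure_image_le (d := (d : ℝ)) (by positivity) S
  rw [h0, mul_zero, hvol] at h1
  exact le_antisymm ((measure_mono hUS).trans h1) bot_le

theorem exists_surjective_of_lt_finrank {V : Type*} [NormedAddCommGroup V] [NormedSpace ℝ V]
    [FiniteDimensional ℝ V] {d : ℕ} (hd : d < Module.finrank ℝ V) :
    ∃ π : V →L[ℝ] (Fin d → ℝ), Function.Surjective π ∧ ∃ w : V, w ≠ 0 ∧ π w = 0 := by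
  let b := Module.finBasis ℝ V
  let π : V →ₗ[ℝ] (Fin d → ℝ) :=
    LinearMap.funLeft ℝ ℝ (Fin.castLE hd.le) ∘ₗ b.equivFun.toLinearMap
  have hker : LinearMap.ker π ≠ ⊥ := π.ker_ne_bot_of_finrank_lt (by simpa using hd)
  obtain ⟨w, hw, hw0⟩ := Submodule.exists_mem_ne_zero_of_ne_bot hker
  refine ⟨LinearMap.toContinuousLinearMap π, ?_, w, hw0, hw⟩
  exact (LinearMap.funLeft_surjective_of_injective ℝ ℝ _ (Fin.castLE_injective hd.le)).comp
    b.equivFun.surjective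

variable {N M : ℕ} {A : Matrix (Fin N) (Fin N) ℝ} {B : Matrix (Fin N) (Fin M) ℝ}

theorem finrank_span_columnFlow_le (τ : ℝ) :
    Module.finrank ℝ (Submodule.span ℝ (range fun i => columnFlow A B i τ)) ≤ B.rank := by
  let L : (Fin N → ℝ) →ₗ[ℝ] EuclideanSpace ℝ (Fin N) :=
    (WithLp.linearEquiv 2 ℝ (Fin N → ℝ)).symm.toLinearMap ∘ₗ
      (NormedSpace.exp (-τ • A)).mulVecLin
  have : (range fun i => columnFlow A B i τ) = L '' range B.col := by
    rw [← range_comp]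
    rfl
  rw [this, Submodule.span_image, Matrix.rank_eq_finrank_span_cols]
  exact Submodule.finrank_map_le _ _

theorem hausdorffMeasure_nonLipFront_pos {T τ : ℝ} (hM : 0 < M)
    (h : FinitelyManySwitches (columnFlow A B) 0 T) (hτ : 0 < τ) (hτT : τ < T)
    (hrank : B.rank < N) :
    0 < (μH[(N : ℝ) - 1 - (B.rank : ℝ)] : Measure (EuclideanSpace ℝ (Fin N)))
      (nonLipFront A B τ) := by
  have hg := continuous_columnFlow A B
  obtain ⟨d, hd⟩ : ∃ d : ℕ, N = B.rank + d + 1 := ⟨N - B.rank - 1, by omega⟩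
  have hexp : (N : ℝ) - 1 - (B.rank : ℝ) = d := by
    have : (N : ℝ) = (B.rank : ℝ) + d + 1 := by exact_mod_cast hd
    linarith
  rw [hexp]
  set V := (Submodule.span ℝ (range fun i => columnFlow A B i τ))ᗮ with hV
  -- The strict inequality leaves a nonzero kernel direction for the projection to `ℝ^d`, which is
  -- needed to reach the frontier.
  have hdV : d < Module.finrank ℝ V := by
    have h1 := Submodule.finrank_add_finrank_orthogonal
      (Submodule.span ℝ (range fun i => columnFlow A B i τ))
    have h2 := finrank_span_columnFlow_le (A := A) (B := B) τ
    rw [finrank_euclideanSpace_fin, ← hV] at h1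
    omega
  obtain ⟨π, hπ, w, hw, hπw⟩ := exists_surjective_of_lt_finrank hdV
  set P := V.orthogonalProjectionOnto with hP
  have hPsurj : Function.Surjective P := fun v => ⟨v, by simp [hP]⟩
  set C := steerSet (columnFlow A B) 0 τ with hC
  have hFMS := h.mono le_rfl hτT.le
  have h0 : (0 : EuclideanSpace ℝ (Fin N)) ∈ interior C := zero_mem_interior_steerSet hg hM hτ hFMS
  have hcomp : IsCompact C := Metric.isCompact_of_isClosed_isBounded
    (isClosed_steerSet hg hM hτ hFMS) (isBounded_steerSet hg 0 τ)
  -- A normal supporting the projection is a vector of `V`; it also supports `C` at `x` and is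
  -- orthogonal to every column at time τ.
  have hfront : frontier (P '' C) ⊆ P '' nonLipFront A B τ := by
    intro y hy
    obtain ⟨x, hx, rfl⟩ := (hcomp.image P.continuous).isClosed.frontier_subset hy
    have hint : (interior (P '' C)).Nonempty :=
      ⟨P 0, (P.isOpenMap hPsurj).image_interior_subset C ⟨0, h0, rfl⟩⟩
    obtain ⟨ζ, hζ, hmax⟩ := exists_unit_normal_of_notMem_interior
      ((convex_steerSet hg 0 τ).is_linear_image P.isLinear) hint hy.2
    refine ⟨x, mem_nonLipFront_of_normal hM h hτ hτT hx (ζ := (ζ : EuclideanSpace ℝ (Fin N)))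
      (by simpa using hζ) (fun i => ?_) ?_, rfl⟩
    · exact (Submodule.mem_orthogonal' _ _).1 ζ.2 _ (Submodule.subset_span ⟨i, rfl⟩)
    · have h1 := hmax _ (subset_closure ⟨_, extremal_mem_steerSet hg 0 τ ζ, rfl⟩)
      have hin : ∀ z, inner ℝ ζ (P z) = inner ℝ (ζ : EuclideanSpace ℝ (Fin N)) z :=
        fun z => Submodule.inner_orthogonalProjectionOnto_eq_of_mem_left ζ z
      have h2 : inner ℝ ζ (P (extremal (columnFlow A B) 0 τ ζ)) ≤ inner ℝ ζ (P x) := h1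
      rwa [hin, hin, inner_extremal hg] at h2
  refine hausdorffMeasure_pos_of_isOpen_subset_image (π.comp P) (U := (π.comp P) '' interior C)
    (((π.comp P).isOpenMap (hπ.comp hPsurj)) _ isOpen_interior) ⟨_, 0, h0, rfl⟩ ?_
  have hbd : Bornology.IsBounded (P '' C) := (hcomp.image P.continuous).isBounded
  have := image_interior_subset_image_frontier (π : V →ₗ[ℝ] (Fin d → ℝ)) hw hπw hbd
  calc (π.comp P) '' interior C ⊆ π '' (P '' C) := by
        rw [← image_comp]
        exact image_mono interior_subset
    _ ⊆ π '' frontier (P '' C) := this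
    _ ⊆ π '' (P '' nonLipFront A B τ) := image_mono hfront
    _ = (π.comp P) '' nonLipFront A B τ := by rw [← image_comp]; rfl

/-- The exceptional points have neighborhoods in which `S` is null, so they form a locally null set;
second countability makes it null. -/
theorem ae_pos_measure_nhds_inter {X : Type*} [TopologicalSpace X] [SecondCountableTopology X]
    [MeasurableSpace X] (μ : Measure X) (S : Set X) :
    ∀ᵐ x ∂μ, x ∈ S → ∀ V ∈ 𝓝 x, 0 < μ (V ∩ S) := by
  rw [ae_iff]
  refine measure_null_of_locally_null _ fun x hx => ?_
  simp only [mem_ofPred_eq, Classical.not_imp, not_forall, not_lt, nonpos_iff_eq_zero] at hx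
  obtain ⟨-, V, hV, hV0⟩ := hx
  refine ⟨V ∩ S, ?_, hV0⟩
  refine mem_nhdsWithin_iff_exists_mem_nhds_inter.2 ⟨V, hV, fun z hz => ⟨hz.1, ?_⟩⟩
  have := hz.2
  simp only [mem_ofPred_eq, Classical.not_imp] at this
  exact this.1

/-! ### Rolle's theorem and bounds on the number of zeros. -/

section Rolle

/-- Rolle points lie strictly between consecutive zeros; this disjointness later allows a double
zero to be counted twice. -/
theorem exists_zeros_of_deriv {f f' : ℝ → ℝ} (hf : ∀ t, HasDerivAt f (f' t) t) {a b : ℝ}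
    {Z : Finset ℝ} {n : ℕ} (hZ : ∀ z ∈ Z, z ∈ Icc a b) (hfZ : ∀ z ∈ Z, f z = 0)
    (hcard : Z.card = n + 1) :
    ∃ Z' : Finset ℝ, (∀ z ∈ Z', z ∈ Icc a b) ∧ (∀ z ∈ Z', f' z = 0) ∧ Z'.card = n ∧
      Disjoint Z Z' := by
  let e := Z.orderEmbOfFin hcard
  have hmem : ∀ i, e i ∈ Z := Z.orderEmbOfFin_mem hcard
  have hex : ∀ i : Fin n, ∃ ξ ∈ Ioo (e i.castSucc) (e i.succ), f' ξ = 0 := fun i =>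
    exists_hasDerivAt_eq_zero (e.strictMono i.castSucc_lt_succ)
      (fun t _ => (hf t).continuousAt.continuousWithinAt)
      ((hfZ _ (hmem _)).trans (hfZ _ (hmem _)).symm) fun t _ => hf t
  choose ξ hξ hξ0 using hex
  have hmono : StrictMono ξ := fun i j hij =>
    (hξ i).2.trans_le ((e.monotone (Fin.succ_le_castSucc_iff.2 hij)).trans (hξ j).1.le)
  refine ⟨Finset.univ.image ξ, ?_, ?_, ?_, ?_⟩
  · simp only [Finset.mem_image, Finset.mem_univ, true_and, forall_exists_index,
      forall_apply_eq_imp_iff]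
    exact fun i => ⟨(hZ _ (hmem _)).1.trans (hξ i).1.le, (hξ i).2.le.trans (hZ _ (hmem _)).2⟩
  · simpa using hξ0
  · rw [Finset.card_image_of_injective _ hmono.injective, Finset.card_fin]
  · refine Finset.disjoint_left.2 fun z hz hz' => ?_
    obtain ⟨i, -, rfl⟩ := Finset.mem_image.1 hz'
    obtain ⟨k, hk⟩ : ∃ k, e k = ξ i := by
      have : ξ i ∈ Set.range e := by
        rw [Finset.range_orderEmbOfFin]
        exact hz
      exact this
    have h1 := e.lt_iff_lt.1 (hk ▸ (hξ i).1 : e i.castSucc < e k)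
    have h2 := e.lt_iff_lt.1 (hk ▸ (hξ i).2 : e k < e i.succ)
    simp only [Fin.lt_def, Fin.val_castSucc, Fin.val_succ] at h1 h2
    omega

/-- Each derivative costs one zero. The minus sign matches the derivative of `e^{-tA} A^j b`. -/
theorem exists_zero_of_iterated_deriv {h : ℕ → ℝ → ℝ}
    (hh : ∀ j t, HasDerivAt (h j) (-h (j + 1) t) t) {a b : ℝ} (n : ℕ) :
    ∀ (m : ℕ) (Z : Finset ℝ), (∀ z ∈ Z, z ∈ Icc a b) → (∀ z ∈ Z, h m z = 0) → Z.card = n →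
      ∀ j < n, ∃ ξ ∈ Icc a b, h (m + j) ξ = 0 := by
  induction n with
  | zero => intro _ _ _ _ _ j hj; omega
  | succ n ih =>
    intro m Z hZ hZ0 hcard j hj
    rcases j with _ | j
    · obtain ⟨z, hz⟩ := Finset.card_pos.1 (show 0 < Z.card by omega)
      exact ⟨z, hZ z hz, hZ0 z hz⟩
    · obtain ⟨Z', hZ', hZ0', hcard', -⟩ := exists_zeros_of_deriv (hh m) hZ hZ0 hcard
      obtain ⟨ξ, hξ, hξ0⟩ := ih (m + 1) Z' hZ' (fun z hz => by simpa using hZ0' z hz) hcard' j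
        (by omega)
      exact ⟨ξ, hξ, by rwa [show m + (j + 1) = m + 1 + j by ring]⟩

end Rolle

variable {N M : ℕ} {A : Matrix (Fin N) (Fin N) ℝ} {B : Matrix (Fin N) (Fin M) ℝ}

/-- The vectors `e^{-tA} A^j b_i`, which are the derivatives of `columnFlow` up to sign. -/
noncomputable def columnFlowDeriv (A : Matrix (Fin N) (Fin N) ℝ) (B : Matrix (Fin N) (Fin M) ℝ)
    (i : Fin M) (j : ℕ) (t : ℝ) : EuclideanSpace ℝ (Fin N) :=
  NormedSpace.exp ((-t) • Matrix.toEuclideanCLM (𝕜 := ℝ) A)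
    (WithLp.toLp 2 ((A ^ j) *ᵥ Bᵀ i))

theorem columnFlowDeriv_zero (A : Matrix (Fin N) (Fin N) ℝ) (B : Matrix (Fin N) (Fin M) ℝ)
    (i : Fin M) (t : ℝ) : columnFlowDeriv A B i 0 t = columnFlow A B i t := by
  rw [columnFlowDeriv, columnFlow_eq_exp_apply, pow_zero, Matrix.one_mulVec]

theorem hasDerivAt_columnFlowDeriv (A : Matrix (Fin N) (Fin N) ℝ)
    (B : Matrix (Fin N) (Fin M) ℝ) (i : Fin M) (j : ℕ) (t : ℝ) :
    HasDerivAt (columnFlowDeriv A B i j) (-columnFlowDeriv A B i (j + 1) t) t := by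
  refine ((hasDerivAt_exp_neg_smul (Matrix.toEuclideanCLM (𝕜 := ℝ) A) t).clm_apply
    (hasDerivAt_const t (WithLp.toLp 2 ((A ^ j) *ᵥ Bᵀ i)))).congr_deriv ?_
  simp only [map_zero, add_zero, columnFlowDeriv, neg_apply, mul_apply_eq_comp,
    Matrix.toEuclideanCLM_toLp, Matrix.mulVec_mulVec, pow_succ']

theorem hasDerivAt_inner_columnFlowDeriv (A : Matrix (Fin N) (Fin N) ℝ)
    (B : Matrix (Fin N) (Fin M) ℝ) (i : Fin M) (ζ : EuclideanSpace ℝ (Fin N)) (j : ℕ) (t : ℝ) :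
    HasDerivAt (fun s => inner ℝ ζ (columnFlowDeriv A B i j s))
      (-inner ℝ ζ (columnFlowDeriv A B i (j + 1) t)) t := by
  refine ((innerSL ℝ ζ).hasFDerivAt.comp_hasDerivAt t
    (hasDerivAt_columnFlowDeriv A B i j t)).congr_deriv ?_
  simp

/-- The nondegeneracy behind all zero counts on `[0, T]`: a vector that annihilates one value of
each of the first `N` derivatives of `e^{-tA} b_i` vanishes. -/
def IsDisconjugate (A : Matrix (Fin N) (Fin N) ℝ) (B : Matrix (Fin N) (Fin M) ℝ) (i : Fin M)
    (T : ℝ) : Prop :=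
  ∀ ζ : EuclideanSpace ℝ (Fin N),
    (∀ j < N, ∃ ξ ∈ Icc 0 T, inner ℝ ζ (columnFlowDeriv A B i j ξ) = 0) → ζ = 0

theorem exp_neg_zero_smul {E : Type*} [NormedAddCommGroup E] [NormedSpace ℝ E] (L : E →L[ℝ] E) :
    NormedSpace.exp ((-(0 : ℝ)) • L) = 1 := by
  rw [neg_zero, zero_smul, NormedSpace.exp_zero]

/-- The matrix whose column `j` is `e^{-ξ_j A} A^j b` is the Kalman matrix at `ξ = 0`, so its
determinant stays nonzero for all small `ξ`, with the times `ξ_j` chosen independently. -/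
theorem eventually_isDisconjugate (hnormal : IsNormal A B) (i : Fin M) :
    ∀ᶠ T in 𝓝[>] (0 : ℝ), IsDisconjugate A B i T := by
  let D : (Fin N → ℝ) → Matrix (Fin N) (Fin N) ℝ := fun ξ =>
    Matrix.of fun r j => columnFlowDeriv A B i j (ξ j) r
  have hc : Continuous D := by
    refine continuous_matrix fun r j => ?_
    have h1 : Continuous (columnFlowDeriv A B i j) :=
      continuous_iff_continuousAt.2 fun t => (hasDerivAt_columnFlowDeriv A B i j t).continuousAt
    have h2 := h1.comp (continuous_apply (A := fun _ : Fin N => ℝ) j)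
    exact (EuclideanSpace.proj (𝕜 := ℝ) r).continuous.comp h2
  have h0 : (D 0).det ≠ 0 := by
    have hD : D 0 = Matrix.of fun (r j : Fin N) => ((A ^ (j : ℕ)) *ᵥ Bᵀ i) r := by
      ext r j
      have hone : ∀ L : EuclideanSpace ℝ (Fin N) →L[ℝ] EuclideanSpace ℝ (Fin N),
          NormedSpace.exp ((-(0 : ℝ)) • L) = 1 := exp_neg_zero_smul
      simp only [D, columnFlowDeriv, Matrix.of_apply, Pi.zero_apply, hone, one_apply_eq_self]
    have hr := hnormal i
    rw [← hD] at hr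
    rw [← isUnit_iff_ne_zero, ← Matrix.isUnit_iff_isUnit_det,
      ← Matrix.linearIndependent_cols_iff_isUnit, linearIndependent_iff_card_eq_finrank_span,
      Fintype.card_fin, Set.finrank, ← Matrix.rank_eq_finrank_span_cols, hr]
  have hev : ∀ᶠ ξ in 𝓝 (0 : Fin N → ℝ), (D ξ).det ≠ 0 :=
    (hc.matrix_det.tendsto 0).eventually (isOpen_ne.mem_nhds h0)
  obtain ⟨ε, hε, hball⟩ := Metric.eventually_nhds_iff_ball.1 hev
  filter_upwards [Ioo_mem_nhdsGT hε] with T hT ζ hζ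
  have hζ' : ∀ j : Fin N, ∃ ξ ∈ Icc 0 T, inner ℝ ζ (columnFlowDeriv A B i j ξ) = 0 :=
    fun j => hζ j j.2
  choose ξ hξ hξ0 using hζ'
  have hdet := hball ξ (by
    rw [mem_ball_zero_iff, pi_norm_lt_iff hε]
    intro j
    rw [Real.norm_of_nonneg (hξ j).1]
    exact (hξ j).2.trans_lt hT.2)
  have hv : (ζ : EuclideanSpace ℝ (Fin N)).ofLp ᵥ* D ξ = 0 := by
    ext j
    have := hξ0 j
    rw [PiLp.inner_apply] at this
    simpa [Matrix.vecMul, dotProduct, D, mul_comm] using this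
  have := Matrix.eq_zero_of_vecMul_eq_zero hdet hv
  ext r
  simp [this]

variable {i : Fin M} {T : ℝ} {ζ : EuclideanSpace ℝ (Fin N)}

theorem IsDisconjugate.card_zeros_lt (h : IsDisconjugate A B i T) (hζ : ζ ≠ 0) {Z : Finset ℝ}
    (hZ : ∀ z ∈ Z, z ∈ Icc 0 T) (hZ0 : ∀ z ∈ Z, inner ℝ ζ (columnFlow A B i z) = 0) :
    Z.card < N := by
  by_contra! hN
  refine hζ (h ζ fun j hj => ?_)
  obtain ⟨ξ, hξ, hξ0⟩ := exists_zero_of_iterated_deriv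
    (h := fun j s => inner ℝ ζ (columnFlowDeriv A B i j s))
    (hasDerivAt_inner_columnFlowDeriv A B i ζ) Z.card 0 Z hZ
    (fun z hz => by simpa [columnFlowDeriv_zero] using hZ0 z hz) rfl j (by omega)
  exact ⟨ξ, hξ, by simpa using hξ0⟩

/-- If `z` were a double zero, it would join the `N - 2` Rolle points as a further zero of the
derivative; those `N - 1` zeros then supply one zero of every higher derivative, forcing `ζ = 0`. -/
theorem IsDisconjugate.deriv_ne_zero (h : IsDisconjugate A B i T) (hζ : ζ ≠ 0) {Z : Finset ℝ}
    (hZ : ∀ z ∈ Z, z ∈ Icc 0 T) (hZ0 : ∀ z ∈ Z, inner ℝ ζ (columnFlow A B i z) = 0)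
    (hcard : Z.card + 1 = N) {z : ℝ} (hz : z ∈ Z) :
    inner ℝ ζ (columnFlowDeriv A B i 1 z) ≠ 0 := by
  intro hz1
  obtain ⟨n, hn⟩ : ∃ n, Z.card = n + 1 :=
    ⟨Z.card - 1, by have := Finset.card_pos.2 ⟨z, hz⟩; omega⟩
  obtain ⟨Z', hZ', hZ0', hcard', hdisj⟩ := exists_zeros_of_deriv
    (hasDerivAt_inner_columnFlowDeriv A B i ζ 0) hZ
    (fun z hz => by simpa [columnFlowDeriv_zero] using hZ0 z hz) hn
  have hzn : z ∉ Z' := Finset.disjoint_left.1 hdisj hz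
  have key := exists_zero_of_iterated_deriv
    (h := fun j s => inner ℝ ζ (columnFlowDeriv A B i j s))
    (hasDerivAt_inner_columnFlowDeriv A B i ζ) (a := 0) (b := T) (n + 1) 1
    (insert z Z')
    (fun w hw => ?_) (fun w hw => ?_) (by rw [Finset.card_insert_of_notMem hzn, hcard'])
  · refine hζ (h ζ fun j hj => ?_)
    rcases j with _ | j
    · exact ⟨z, hZ z hz, by simpa [columnFlowDeriv_zero] using hZ0 z hz⟩
    · obtain ⟨ξ, hξ, hξ0⟩ := key j (by omega)
      exact ⟨ξ, hξ, by rwa [add_comm j 1]⟩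
  · rcases Finset.mem_insert.1 hw with rfl | hw
    · exact hZ w hz
    · exact hZ' w hw
  · rcases Finset.mem_insert.1 hw with rfl | hw
    · exact hz1
    · simpa using hZ0' w hw

theorem IsDisconjugate.finite_zeros (h : IsDisconjugate A B i T) (hζ : ζ ≠ 0) :
    {s ∈ Icc 0 T | inner ℝ ζ (columnFlow A B i s) = 0}.Finite := by
  by_contra hinf
  obtain ⟨Z, hZ, hcard⟩ := Set.Infinite.exists_subset_card_eq hinf N
  exact (h.card_zeros_lt hζ (fun z hz => (hZ hz).1) fun z hz => (hZ hz).2).ne hcard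

theorem exists_finitelyManySwitches (hnormal : IsNormal A B) :
    ∃ T : ℝ, 0 < T ∧ (∀ i, IsDisconjugate A B i T) ∧
      FinitelyManySwitches (columnFlow A B) 0 T := by
  obtain ⟨T, hT, hT0⟩ := ((eventually_all.2 (eventually_isDisconjugate hnormal)).and
    self_mem_nhdsWithin).exists
  exact ⟨T, hT0, hT, fun ζ hζ i => (hT i).finite_zeros hζ⟩

theorem exists_unit_orthogonal {E : Type*} [NormedAddCommGroup E] [InnerProductSpace ℝ E]
    [FiniteDimensional ℝ E] (Z : Finset ℝ) (g : ℝ → E) (hZ : Z.card < Module.finrank ℝ E) :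
    ∃ ζ : E, ‖ζ‖ = 1 ∧ ∀ z ∈ Z, inner ℝ ζ (g z) = 0 := by
  classical
  set W := Submodule.span ℝ ((Z.image g : Finset E) : Set E) with hW
  have hle : Module.finrank ℝ W ≤ Z.card :=
    (finrank_span_finset_le_card _).trans Finset.card_image_le
  have hsum := Submodule.finrank_add_finrank_orthogonal W
  have hne : Wᗮ ≠ ⊥ := by
    intro hbot
    rw [hbot, finrank_bot] at hsum
    omega
  obtain ⟨ξ, hξ, hξ0⟩ := Submodule.exists_mem_ne_zero_of_ne_bot hne
  refine ⟨(‖ξ‖⁻¹ : ℝ) • ξ, by simp [norm_smul, norm_ne_zero_iff.2 hξ0], fun z hz => ?_⟩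
  rw [inner_smul_left, (Submodule.mem_orthogonal' _ _).1 hξ _
    (Submodule.subset_span (by simpa using ⟨z, hz, rfl⟩)), mul_zero]

/-! ### Sign patterns and bang-bang controls. -/

section Signs

theorem forall_pos_or_forall_neg {q : ℝ → ℝ} {I : Set ℝ} (hI : IsPreconnected I)
    (hq : ContinuousOn q I) (h0 : ∀ t ∈ I, q t ≠ 0) :
    (∀ t ∈ I, 0 < q t) ∨ ∀ t ∈ I, q t < 0 := by
  by_contra! hcon
  obtain ⟨⟨a, ha, hqa⟩, b, hb, hqb⟩ := hcon
  obtain ⟨t, ht, hqt⟩ := hI.intermediate_value ha hb hq ⟨hqa, hqb⟩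
  exact h0 t ht hqt

/-- Two functions with the same zeros, all of them simple, have a product of constant sign. -/
theorem mul_nonneg_or_mul_nonpos_of_simple_zeros {f f' p p' : ℝ → ℝ} {a b : ℝ}
    (hf : ∀ t, HasDerivAt f (f' t) t) (hp : ∀ t, HasDerivAt p (p' t) t)
    (hfp : ∀ t ∈ Ioo a b, f t = 0 ↔ p t = 0) (hf' : ∀ t ∈ Ioo a b, f t = 0 → f' t ≠ 0)
    (hp' : ∀ t ∈ Ioo a b, p t = 0 → p' t ≠ 0) :
    (∀ t ∈ Ioo a b, 0 ≤ f t * p t) ∨ ∀ t ∈ Ioo a b, f t * p t ≤ 0 := by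
  classical
  -- The quotient `f / p`, filled in by its limit `f' / p'` at the common zeros, is continuous and
  -- never zero.
  set q : ℝ → ℝ := fun t => if f t = 0 then f' t / p' t else f t / p t with hq
  have hq0 : ∀ t ∈ Ioo a b, q t ≠ 0 := by
    intro t ht
    simp only [hq]
    split_ifs with h
    · exact div_ne_zero (hf' t ht h) (hp' t ht ((hfp t ht).1 h))
    · exact div_ne_zero h fun h0 => h ((hfp t ht).2 h0)
  have hne : ∀ {h : ℝ → ℝ} {h' : ℝ} {t : ℝ}, HasDerivAt h h' t → h' ≠ 0 →
      ∀ᶠ s in 𝓝[≠] t, h s ≠ h t := fun hh hh' => hh.eventually_ne hh'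
  have hqc : ContinuousOn q (Ioo a b) := by
    intro t ht
    refine ContinuousAt.continuousWithinAt ?_
    by_cases h : f t = 0
    · have hpt := (hfp t ht).1 h
      have hlim : Tendsto (fun s => slope f t s / slope p t s) (𝓝[≠] t) (𝓝 (q t)) := by
        have := (hasDerivAt_iff_tendsto_slope.1 (hf t)).div
          (hasDerivAt_iff_tendsto_slope.1 (hp t)) (hp' t ht hpt)
        simpa [hq, h] using! this
      rw [continuousAt_iff_punctured_nhds]
      refine hlim.congr' ?_
      filter_upwards [hne (hf t) (hf' t ht h), self_mem_nhdsWithin] with s hs hst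
      have hst' : s - t ≠ 0 := sub_ne_zero.2 hst
      rw [h] at hs
      simp only [hq, hs, if_false, slope_def_field, h, hpt, sub_zero]
      rw [div_div_div_cancel_right₀ hst']
    · have hpt : p t ≠ 0 := fun h0 => h ((hfp t ht).2 h0)
      have : q =ᶠ[𝓝 t] fun s => f s / p s := by
        filter_upwards [(hf t).continuousAt.eventually_ne h] with s hs
        simp [hq, hs]
      exact ((hf t).continuousAt.div (hp t).continuousAt hpt).congr this.symm
  have hfq : ∀ t ∈ Ioo a b, f t * p t = q t * (p t * p t) := by
    intro t ht
    by_cases h : f t = 0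
    · rw [h, (hfp t ht).1 h]; ring
    · have hpt : p t ≠ 0 := fun h0 => h ((hfp t ht).2 h0)
      simp only [hq, h, if_false]
      field_simp
  refine (forall_pos_or_forall_neg isPreconnected_Ioo hqc hq0).imp (fun h t ht => ?_)
    fun h t ht => ?_
  · rw [hfq t ht]; exact mul_nonneg (h t ht).le (mul_self_nonneg _)
  · rw [hfq t ht]; exact mul_nonpos_of_nonpos_of_nonneg (h t ht).le (mul_self_nonneg _)

/-- If `f` has a simple zero at `a` and `f p` is nonnegative near `a`, then `p` vanishes at `a`. -/
theorem eq_zero_of_mul_nonneg_of_simple_zero {f p : ℝ → ℝ} {a f' p' : ℝ}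
    (hf : HasDerivAt f f' a) (hp : HasDerivAt p p' a) (hfa : f a = 0) (hf' : f' ≠ 0)
    (h : ∀ᶠ t in 𝓝 a, 0 ≤ f t * p t) : p a = 0 := by
  -- The product is minimal at `a`, where its derivative reduces to `f' * p a`.
  have hmin : IsLocalMin (fun t => f t * p t) a := by
    filter_upwards [h] with t ht
    rw [hfa, zero_mul]
    exact ht
  have := hmin.hasDerivAt_eq_zero (hf.mul hp)
  rw [hfa, zero_mul, add_zero] at this
  exact (mul_eq_zero.1 this).resolve_left hf'

end Signs

section BangBang

variable {d : ℕ}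

/-- The polynomial `∏ (sᵢ - t)`, whose sign is that of `bangBang s`. -/
noncomputable def switchingPoly (s : EuclideanSpace ℝ (Fin d)) (t : ℝ) : ℝ := ∏ i, (s i - t)

theorem switchingPoly_eq_zero_iff {s : EuclideanSpace ℝ (Fin d)} {t : ℝ} :
    switchingPoly s t = 0 ↔ ∃ i, s i = t := by
  simp [switchingPoly, Finset.prod_eq_zero_iff, sub_eq_zero]

theorem hasDerivAt_switchingPoly (s : EuclideanSpace ℝ (Fin d)) (t : ℝ) :
    HasDerivAt (switchingPoly s) (-∑ i, ∏ j ∈ Finset.univ.erase i, (s j - t)) t := by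
  have h := HasDerivAt.fun_finsetProd (u := Finset.univ) (f := fun (i : Fin d) t => s i - t)
    (f' := fun _ => -1) (x := t) fun i _ => by simpa using (hasDerivAt_id t).const_sub (s i)
  refine h.congr_deriv ?_
  simp

theorem deriv_switchingPoly_ne_zero {s : EuclideanSpace ℝ (Fin d)}
    (hs : Function.Injective fun i => s i) {t : ℝ} (ht : switchingPoly s t = 0) :
    -∑ i, ∏ j ∈ Finset.univ.erase i, (s j - t) ≠ 0 := by
  obtain ⟨k, rfl⟩ := switchingPoly_eq_zero_iff.1 ht
  rw [neg_ne_zero, Finset.sum_eq_single k]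
  · refine Finset.prod_ne_zero_iff.2 fun j hj => ?_
    exact sub_ne_zero.2 fun h => (Finset.mem_erase.1 hj).1 (hs h)
  · intro i _ hik
    exact Finset.prod_eq_zero (Finset.mem_erase.2 ⟨hik.symm, Finset.mem_univ k⟩) (sub_self _)
  · simp

theorem bangBang_mul_abs_switchingPoly (s : EuclideanSpace ℝ (Fin d)) (t : ℝ) :
    bangBang s t * |switchingPoly s t| = switchingPoly s t := by
  have h1 : bangBang s t = ∏ i, if s i < t then (-1 : ℝ) else 1 := by
    rw [Finset.prod_ite, Finset.prod_const, Finset.prod_const_one, mul_one, bangBang]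
  rw [h1, switchingPoly, Finset.abs_prod, ← Finset.prod_mul_distrib]
  refine Finset.prod_congr rfl fun i _ => ?_
  split_ifs with h
  · rw [abs_of_neg (sub_neg.2 h)]; ring
  · rw [abs_of_nonneg (sub_nonneg.2 (not_lt.1 h)), one_mul]

theorem bangBang_eq_or (s : EuclideanSpace ℝ (Fin d)) (t : ℝ) :
    bangBang s t = 1 ∨ bangBang s t = -1 := neg_one_pow_eq_or ℝ _

theorem abs_bangBang (s : EuclideanSpace ℝ (Fin d)) (t : ℝ) : |bangBang s t| = 1 := by
  rcases bangBang_eq_or s t with h | h <;> simp [h]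

theorem bangBang_mul_eq_abs_of_mul_nonneg {s : EuclideanSpace ℝ (Fin d)} {t r : ℝ}
    (hr : 0 ≤ r * switchingPoly s t) (h0 : switchingPoly s t = 0 → r = 0) :
    bangBang s t * r = |r| := by
  by_cases hp : switchingPoly s t = 0
  · simp [h0 hp]
  have hb := bangBang_mul_abs_switchingPoly s t
  have hpos := abs_pos.2 hp
  have h1 : 0 ≤ bangBang s t * r := by
    have : 0 ≤ (bangBang s t * r) * |switchingPoly s t| := by
      rw [mul_right_comm, hb, mul_comm]; exact hr
    exact nonneg_of_mul_nonneg_left this hpos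
  rw [← abs_of_nonneg h1, abs_mul, abs_bangBang, one_mul]

/-- Each crossing adds a jump `±2`, alternating in order. In this additive form the switching
integral separates into functions of one switching time each. -/
theorem neg_one_pow_card_filter_lt {d : ℕ} (s : Fin d → ℝ) (hs : StrictMono s) (t : ℝ) :
    (-1 : ℝ) ^ (Finset.univ.filter fun i => s i < t).card =
      1 + ∑ i : Fin d, 2 * (-1) ^ ((i : ℕ) + 1) * (if s i < t then 1 else 0) := by
  induction d with
  | zero => simp
  | succ d ih =>
    have ih' := ih (fun i => s i.castSucc) (hs.comp Fin.strictMono_castSucc)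
    have hcard : (Finset.univ.filter fun i => s i < t).card =
        (Finset.univ.filter fun i : Fin d => s i.castSucc < t).card +
          if s (Fin.last d) < t then 1 else 0 := by
      simp only [Finset.card_filter, Fin.sum_univ_castSucc]
    rw [Fin.sum_univ_castSucc, ← add_assoc]
    simp only [Fin.val_castSucc, Fin.val_last]
    rw [← ih', hcard]
    split_ifs with h
    · have hall : (Finset.univ.filter fun i : Fin d => s i.castSucc < t).card = d := by
        rw [Finset.filter_true_of_mem fun i _ => (hs i.castSucc_lt_last).trans h,
          Finset.card_univ, Fintype.card_fin]
      rw [hall]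
      ring
    · simp

theorem bangBang_eq_sum {s : EuclideanSpace ℝ (Fin d)} (hs : StrictMono fun i => s i) (t : ℝ) :
    bangBang s t = 1 + ∑ i : Fin d, 2 * (-1) ^ ((i : ℕ) + 1) * (if s i < t then 1 else 0) :=
  neg_one_pow_card_filter_lt _ hs t

theorem measurable_bangBang {s : EuclideanSpace ℝ (Fin d)} (hs : StrictMono fun i => s i) :
    Measurable (bangBang s) := by
  rw [funext (bangBang_eq_sum hs)]
  refine measurable_const.add (Finset.measurable_fun_sum _ fun i _ => measurable_const.mul ?_)
  exact Measurable.ite measurableSet_Ioi measurable_const measurable_const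

theorem isOpen_switchingTimes (d : ℕ) (τ : ℝ) : IsOpen (switchingTimes d τ) := by
  have hc : ∀ i, Continuous fun s : EuclideanSpace ℝ (Fin d) => s i := fun i =>
    (EuclideanSpace.proj (𝕜 := ℝ) i).continuous
  have : switchingTimes d τ = (⋂ i, {s | s i ∈ Ioo 0 τ}) ∩
      ⋂ i, ⋂ j, ⋂ _ : i < j, {s : EuclideanSpace ℝ (Fin d) | s i < s j} := by
    ext s
    simp [switchingTimes, StrictMono]
  rw [this]
  refine IsOpen.inter (isOpen_iInter_of_finite fun i => isOpen_Ioo.preimage (hc i)) ?_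
  exact isOpen_iInter_of_finite fun i => isOpen_iInter_of_finite fun j =>
    isOpen_iInter_of_finite fun _ => isOpen_lt (hc i) (hc j)

end BangBang

/-! ### Smooth dependence on the switching times. -/

section SwitchingSum

variable {E : Type*} [NormedAddCommGroup E] [NormedSpace ℝ E] {d : ℕ}

theorem contDiff_primitive [CompleteSpace E] {g : ℝ → E} (hg : ContDiff ℝ ∞ g) :
    ContDiff ℝ ∞ fun t => ∫ s in (0 : ℝ)..t, g s := by
  have hd : ∀ t, HasDerivAt (fun t => ∫ s in (0 : ℝ)..t, g s) (g t) t := fun t =>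
    intervalIntegral.integral_hasDerivAt_right (hg.continuous.intervalIntegrable _ _)
      (hg.continuous.stronglyMeasurableAtFilter _ _) hg.continuous.continuousAt
  rw [contDiff_infty_iff_deriv]
  refine ⟨fun t => (hd t).differentiableAt, ?_⟩
  rwa [show deriv (fun t => ∫ s in (0 : ℝ)..t, g s) = g from funext fun t => (hd t).deriv]

theorem integral_bangBang_smul {g : ℝ → E} (hg : Continuous g) {τ : ℝ}
    {s : EuclideanSpace ℝ (Fin d)} (hs : s ∈ switchingTimes d τ) :
    ∫ t in (0 : ℝ)..τ, bangBang s t • g t =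
      (∫ t in (0 : ℝ)..τ, g t) + ∑ i : Fin d, (2 * (-1 : ℝ) ^ ((i : ℕ) + 1)) •
        ((∫ t in (0 : ℝ)..τ, g t) - ∫ t in (0 : ℝ)..(s i), g t) := by
  have hint : ∀ a b, IntervalIntegrable g volume a b := fun a b => hg.intervalIntegrable a b
  have hite : ∀ (i : Fin d) a b,
      IntervalIntegrable (fun t => if s i < t then g t else 0) volume a b := by
    intro i a b
    have := (hint a b)
    rw [intervalIntegrable_iff] at this ⊢
    exact (this.indicator (measurableSet_Ioi (a := s i))).congr (ae_of_all _ fun t => by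
      simp [indicator_apply])
  have hpiece : ∀ i : Fin d, ∫ t in (0 : ℝ)..τ, (if s i < t then g t else 0) =
      (∫ t in (0 : ℝ)..τ, g t) - ∫ t in (0 : ℝ)..(s i), g t := by
    intro i
    rw [intervalIntegral.integral_interval_sub_left (hint _ _) (hint _ _),
      ← intervalIntegral.integral_add_adjacent_intervals (hite i 0 (s i)) (hite i (s i) τ)]
    have h1 : ∫ t in (0 : ℝ)..(s i), (if s i < t then g t else 0) = 0 := by
      rw [← intervalIntegral.integral_zero (a := 0) (b := s i) (μ := volume)]
      refine intervalIntegral.integral_congr fun t ht => ?_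
      rw [uIcc_of_le (hs.1 i).1.le] at ht
      simp [not_lt.2 ht.2]
    rw [h1, zero_add]
    refine intervalIntegral.integral_congr_ae (ae_of_all _ fun t ht => ?_)
    rw [uIoc_of_le (hs.1 i).2.le] at ht
    simp [ht.1]
  have heq : ∀ t, bangBang s t • g t = g t + ∑ i : Fin d, (2 * (-1 : ℝ) ^ ((i : ℕ) + 1)) •
      (if s i < t then g t else 0) := by
    intro t
    rw [bangBang_eq_sum hs.2, add_smul, one_smul, Finset.sum_smul]
    congr 1
    refine Finset.sum_congr rfl fun i _ => ?_
    split_ifs <;> simp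
  have hi : ∀ i : Fin d, IntervalIntegrable (fun t => (2 * (-1 : ℝ) ^ ((i : ℕ) + 1)) •
      (if s i < t then g t else 0)) volume 0 τ := fun i => (hite i 0 τ).smul _
  simp_rw [heq]
  have hsum : IntervalIntegrable (fun t => ∑ i : Fin d, (2 * (-1 : ℝ) ^ ((i : ℕ) + 1)) •
      (if s i < t then g t else 0)) volume 0 τ := by
    have := IntervalIntegrable.sum Finset.univ fun i _ => hi i
    refine this.congr_ae (ae_of_all _ fun t => ?_)
    simp
  rw [intervalIntegral.integral_add (hint _ _) hsum,
    intervalIntegral.integral_finsetSum fun i _ => hi i]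
  simp_rw [intervalIntegral.integral_smul, hpiece]

/-- The smooth extension of the switching map to all of `ℝ^d`. -/
noncomputable def switchingSum (g : ℝ → E) (τ : ℝ) (s : EuclideanSpace ℝ (Fin d)) : E :=
  (∫ t in (0 : ℝ)..τ, g t) + ∑ i : Fin d, (2 * (-1 : ℝ) ^ ((i : ℕ) + 1)) •
    ((∫ t in (0 : ℝ)..τ, g t) - ∫ t in (0 : ℝ)..(s i), g t)

theorem contDiff_switchingSum [CompleteSpace E] {g : ℝ → E} (hg : ContDiff ℝ ∞ g) (τ : ℝ) :
    ContDiff ℝ ∞ (switchingSum (d := d) g τ) := by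
  refine contDiff_const.add (ContDiff.sum fun i _ => contDiff_const.smul
    (contDiff_const.sub ?_))
  exact (contDiff_primitive hg).comp (EuclideanSpace.proj (𝕜 := ℝ) i).contDiff

/-- The derivative in the `i`-th time is `±2 g (s i)`, so the immersion property amounts to
independence of the vectors `g (s i)`. -/
theorem fderiv_switchingSum_apply [CompleteSpace E] {g : ℝ → E} (hg : Continuous g) (τ : ℝ)
    (s v : EuclideanSpace ℝ (Fin d)) :
    fderiv ℝ (switchingSum (d := d) g τ) s v =
      ∑ i : Fin d, (2 * (-1 : ℝ) ^ (i : ℕ) * v i) • g (s i) := by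
  have hG : ∀ t, HasDerivAt (fun t => ∫ s in (0 : ℝ)..t, g s) (g t) t := fun t =>
    intervalIntegral.integral_hasDerivAt_right (hg.intervalIntegrable _ _)
      (hg.stronglyMeasurableAtFilter _ _) hg.continuousAt
  have hcomp : ∀ i : Fin d, HasFDerivAt
      (fun s : EuclideanSpace ℝ (Fin d) => ∫ t in (0 : ℝ)..(s i), g t)
      ((ContinuousLinearMap.toSpanSingleton ℝ (g (s i))).comp (EuclideanSpace.proj (𝕜 := ℝ) i))
      s := fun i => by
    have h1 : HasFDerivAt (fun s : EuclideanSpace ℝ (Fin d) => s i)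
      (EuclideanSpace.proj (𝕜 := ℝ) i) s := (EuclideanSpace.proj (𝕜 := ℝ) i).hasFDerivAt
    exact HasFDerivAt.comp (g := fun t => ∫ s in (0 : ℝ)..t, g s) s (hG (s i)).hasFDerivAt h1
  have h : HasFDerivAt (switchingSum (d := d) g τ)
      (∑ i : Fin d, (2 * (-1 : ℝ) ^ ((i : ℕ) + 1)) •
        -((ContinuousLinearMap.toSpanSingleton ℝ (g (s i))).comp
          (EuclideanSpace.proj (𝕜 := ℝ) i))) s :=
    (HasFDerivAt.fun_sum fun i _ => ((hcomp i).const_sub _).const_smul _).const_add _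
  rw [h.fderiv, sum_apply]
  refine Finset.sum_congr rfl fun i _ => ?_
  simp [pow_succ, smul_smul]

end SwitchingSum

/-! ### Extremal points with fewer switchings. -/

section Strata

variable {E : Type*} [NormedAddCommGroup E] [NormedSpace ℝ E]

theorem intervalIntegrable_signPM_smul {f : ℝ → ℝ} {g : ℝ → E} (hf : Continuous f)
    (hg : Continuous g) (a b : ℝ) :
    IntervalIntegrable (fun t => signPM (f t) • g t) volume a b := by
  refine IntervalIntegrable.smul_continuousOn (f := fun t => signPM (f t)) ?_ hg.continuousOn
  refine IntervalIntegrable.mono_fun' (g := fun _ => (1 : ℝ)) intervalIntegrable_const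
    (measurable_signPM.comp hf.measurable).aestronglyMeasurable (ae_of_all _ fun t => ?_)
  rcases signPM_eq_or (f t) with h | h <;> simp [h]

theorem exists_integral_signPM_eq_zsmul {f : ℝ → ℝ} {g : ℝ → E} (hf : Continuous f) {a b : ℝ}
    (hab : a ≤ b) (h0 : ∀ t ∈ Ioo a b, f t ≠ 0) :
    ∃ c : ℤ, ∫ t in a..b, signPM (f t) • g t = c • ∫ t in a..b, g t := by
  rcases forall_pos_or_forall_neg isPreconnected_Ioo hf.continuousOn h0 with h | h
  · refine ⟨1, ?_⟩
    rw [one_smul, intervalIntegral.integral_of_le hab, intervalIntegral.integral_of_le hab,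
      integral_Ioc_eq_integral_Ioo, integral_Ioc_eq_integral_Ioo]
    refine setIntegral_congr_fun measurableSet_Ioo fun t ht => ?_
    simp [signPM, h t ht]
  · refine ⟨-1, ?_⟩
    rw [neg_one_smul, ← intervalIntegral.integral_neg, intervalIntegral.integral_of_le hab,
      intervalIntegral.integral_of_le hab, integral_Ioc_eq_integral_Ioo,
      integral_Ioc_eq_integral_Ioo]
    refine setIntegral_congr_fun measurableSet_Ioo fun t ht => ?_
    simp [signPM, not_lt.2 (h t ht).le]

/-- The sign is constant between consecutive points of `Z`, and the pieces are differences of one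
primitive. Integer coefficients matter because there are only countably many choices. -/
theorem exists_integral_signPM_eq_sum {f : ℝ → ℝ} {g : ℝ → E} (hf : Continuous f)
    (hg : Continuous g) (Z : Finset ℝ) : ∀ b : ℝ, 0 ≤ b → (∀ z ∈ Z, z ∈ Ioo 0 b) →
      (∀ t ∈ Ioo 0 b, t ∉ Z → f t ≠ 0) →
      ∃ (c₀ : ℤ) (c : ℝ → ℤ), ∫ t in (0 : ℝ)..b, signPM (f t) • g t =
        c₀ • (∫ t in (0 : ℝ)..b, g t) + ∑ z ∈ Z, c z • ∫ t in (0 : ℝ)..z, g t := by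
  have hint : ∀ a b, IntervalIntegrable g volume a b := fun a b => hg.intervalIntegrable a b
  have hints := intervalIntegrable_signPM_smul hf hg
  induction Z using Finset.induction_on_max with
  | empty =>
    intro b hb _ hfb
    obtain ⟨c, hc⟩ := exists_integral_signPM_eq_zsmul (g := g) hf hb fun t ht => hfb t ht (by simp)
    exact ⟨c, 0, by simpa using hc⟩
  | insert a Z ha ih =>
    intro b hb hZ hfb
    have haI := hZ a (Finset.mem_insert_self a Z)
    obtain ⟨c₀, c, hc⟩ := ih a haI.1.le
      (fun z hz => ⟨(hZ z (Finset.mem_insert_of_mem hz)).1, ha z hz⟩) fun t ht htZ =>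
        hfb t ⟨ht.1, ht.2.trans haI.2⟩ (by simp [htZ, ht.2.ne])
    obtain ⟨c₁, hc₁⟩ := exists_integral_signPM_eq_zsmul (g := g) hf haI.2.le fun t ht =>
      hfb t ⟨haI.1.trans ht.1, ht.2⟩ (by
        simp only [Finset.mem_insert, not_or]
        exact ⟨ht.1.ne', fun htZ => (ha t htZ).not_gt ht.1⟩)
    have haZ : a ∉ Z := fun h => (ha a h).false
    -- The final piece is `c₁` times the difference of the primitive at `b` and `a`, which shifts
    -- the coefficient at `a` by `-c₁`.
    refine ⟨c₁, fun z => if z = a then c₀ - c₁ else c z, ?_⟩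
    rw [← intervalIntegral.integral_add_adjacent_intervals (hints 0 a) (hints a b), hc, hc₁,
      Finset.sum_insert haZ,
      ← intervalIntegral.integral_interval_sub_left (hint 0 b) (hint 0 a), smul_sub]
    have : ∑ z ∈ Z, (if z = a then c₀ - c₁ else c z) • ∫ t in (0 : ℝ)..z, g t =
        ∑ z ∈ Z, c z • ∫ t in (0 : ℝ)..z, g t :=
      Finset.sum_congr rfl fun z hz => by rw [if_neg fun h : z = a => haZ (h ▸ hz)]
    simp only [if_true, this, sub_smul]
    abel

/-- Countably many `C¹` images of `ℝ^j` with `j < d`, each of Hausdorff dimension at most `j`. -/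
theorem hausdorffMeasure_integer_combinations [MeasurableSpace E] [BorelSpace E] {G : ℝ → E}
    (hG : ContDiff ℝ 1 G) (v : E) (d : ℕ) :
    (μH[(d : ℝ)] : Measure E) {x | ∃ (Z : Finset ℝ) (c₀ : ℤ) (c : ℝ → ℤ), Z.card < d ∧
      x = c₀ • v + ∑ z ∈ Z, c z • G z} = 0 := by
  have hcover : {x | ∃ (Z : Finset ℝ) (c₀ : ℤ) (c : ℝ → ℤ), Z.card < d ∧
      x = c₀ • v + ∑ z ∈ Z, c z • G z} ⊆ ⋃ (j : Fin d) (c₀ : ℤ) (c : Fin j → ℤ),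
        range fun z : Fin j → ℝ => c₀ • v + ∑ k, c k • G (z k) := by
    rintro x ⟨Z, c₀, c, hZ, rfl⟩
    simp only [mem_iUnion]
    let e := Z.orderIsoOfFin rfl
    refine ⟨⟨Z.card, hZ⟩, c₀, fun k => c (e k), fun k => (e k : ℝ), ?_⟩
    simp only
    congr 1
    rw [← Finset.sum_coe_sort Z fun z => c z • G z]
    exact Equiv.sum_comp e.toEquiv fun z : Z => c z • G z
  refine measure_mono_null hcover ?_
  refine measure_iUnion_null fun j => measure_iUnion_null fun c₀ => measure_iUnion_null fun c => ?_
  have hsmooth : ContDiff ℝ 1 fun z : Fin j → ℝ => c₀ • v + ∑ k, c k • G (z k) := by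
    refine contDiff_const.add (ContDiff.sum fun k _ => ?_)
    have h1 : ContDiff ℝ 1 fun z : Fin j → ℝ => G (z k) := hG.comp (contDiff_apply ℝ ℝ k)
    simp_rw [← Int.cast_smul_eq_zsmul ℝ]
    exact contDiff_const.smul h1
  have hdim := hsmooth.dimH_range_le
  rw [Module.finrank_fin_fun] at hdim
  have hlt : dimH (range fun z : Fin j → ℝ => c₀ • v + ∑ k, c k • G (z k)) <
      ((d : NNReal) : ℝ≥0∞) := hdim.trans_lt (by simp)
  simpa using hausdorffMeasure_of_dimH_lt hlt

end Strata

/-! ### The single-input front and its parametrization. -/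

section SingleInput

variable {N M : ℕ} {A : Matrix (Fin N) (Fin N) ℝ} {B : Matrix (Fin N) (Fin M) ℝ} {i : Fin M}
  {T τ : ℝ}

theorem hasDerivAt_inner_columnFlow (A : Matrix (Fin N) (Fin N) ℝ)
    (B : Matrix (Fin N) (Fin M) ℝ) (i : Fin M) (ζ : EuclideanSpace ℝ (Fin N)) (t : ℝ) :
    HasDerivAt (fun s => inner ℝ ζ (columnFlow A B i s))
      (-inner ℝ ζ (columnFlowDeriv A B i 1 t)) t := by
  simpa [columnFlowDeriv_zero] using! hasDerivAt_inner_columnFlowDeriv A B i ζ 0 t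

/-- The switching times together with the final time. -/
noncomputable def switchingNodes {d : ℕ} (s : EuclideanSpace ℝ (Fin d)) (τ : ℝ) : Finset ℝ :=
  insert τ (Finset.univ.image fun j => s j)

theorem mem_switchingNodes {d : ℕ} {s : EuclideanSpace ℝ (Fin d)} {t : ℝ} :
    t ∈ switchingNodes s τ ↔ t = τ ∨ ∃ j, s j = t := by
  simp [switchingNodes]

theorem card_switchingNodes {d : ℕ} {s : EuclideanSpace ℝ (Fin d)} (hs : s ∈ switchingTimes d τ) :
    (switchingNodes s τ).card = d + 1 := by
  rw [switchingNodes, Finset.card_insert_of_notMem,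
    Finset.card_image_of_injective _ hs.2.injective, Finset.card_fin]
  simp only [Finset.mem_image, Finset.mem_univ, true_and, not_exists]
  exact fun j => (hs.1 j).2.ne

theorem switchingNodes_subset {d : ℕ} {s : EuclideanSpace ℝ (Fin d)} (hτ : 0 < τ) (hτT : τ ≤ T)
    (hs : s ∈ switchingTimes d τ) : ∀ z ∈ switchingNodes s τ, z ∈ Ioc 0 T := by
  intro z hz
  rcases mem_switchingNodes.1 hz with rfl | ⟨j, rfl⟩
  · exact ⟨hτ, hτT⟩
  · exact ⟨(hs.1 j).1, (hs.1 j).2.le.trans hτT⟩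

/-- Values of `e^{-tA} b_i` at switching times are linearly independent. -/
theorem IsDisconjugate.eq_zero_of_sum_smul (h : IsDisconjugate A B i T) (hN : 2 < N) (hτ : 0 < τ)
    (hτT : τ ≤ T) {s : EuclideanSpace ℝ (Fin (N - 2))} (hs : s ∈ switchingTimes (N - 2) τ)
    {c : Fin (N - 2) → ℝ} (hc : ∑ j, c j • columnFlow A B i (s j) = 0) (k : Fin (N - 2)) :
    c k = 0 := by
  have hsub := switchingNodes_subset hτ hτT hs
  have hcard := card_switchingNodes hs
  have h0 : (0 : ℝ) ∉ switchingNodes s τ := fun h0 => (hsub 0 h0).1.false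
  -- Adding time `0` brings the nodes to exactly `N`. Some ζ annihilates the flow at all of them
  -- except `s k`, and it cannot vanish there too.
  set Z := insert 0 (switchingNodes s τ) with hZ
  have hZcard : Z.card = N := by rw [hZ, Finset.card_insert_of_notMem h0, hcard]; omega
  have hZI : ∀ z ∈ Z, z ∈ Icc 0 T := by
    intro z hz
    rcases Finset.mem_insert.1 hz with rfl | hz
    · exact ⟨le_rfl, hτ.le.trans hτT⟩
    · exact Ioc_subset_Icc_self (hsub z hz)
  have hmem : ∀ j, s j ∈ Z := fun j =>
    Finset.mem_insert_of_mem (mem_switchingNodes.2 (Or.inr ⟨j, rfl⟩))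
  obtain ⟨ζ, hζ, hζ0⟩ := exists_unit_orthogonal (Z.erase (s k)) (columnFlow A B i) (by
    rw [Finset.card_erase_of_mem (hmem k), finrank_euclideanSpace_fin]; omega)
  have hζne : ζ ≠ 0 := norm_ne_zero_iff.1 (by simp [hζ])
  have hk : inner ℝ ζ (columnFlow A B i (s k)) ≠ 0 := by
    intro hk
    refine (h.card_zeros_lt hζne hZI fun z hz => ?_).ne hZcard
    by_cases hzk : z = s k
    · rw [hzk, hk]
    · exact hζ0 z (Finset.mem_erase.2 ⟨hzk, hz⟩)
  have hin := congrArg (fun v => inner ℝ ζ v) hc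
  simp only [inner_sum, inner_smul_right, inner_zero_right] at hin
  rw [Finset.sum_eq_single k] at hin
  · exact (mul_eq_zero.1 hin).resolve_right hk
  · intro j _ hjk
    rw [hζ0 (s j) (Finset.mem_erase.2 ⟨fun h => hjk (hs.2.injective h), hmem j⟩), mul_zero]
  · simp

/-- A functional that vanishes at `N - 2` switching times and at `τ` changes sign exactly at the
switching times. -/
theorem IsDisconjugate.bangBang_mul_eq (h : IsDisconjugate A B i T) (hN : 2 < N) (hτ : 0 < τ)
    (hτT : τ ≤ T) {s : EuclideanSpace ℝ (Fin (N - 2))} (hs : s ∈ switchingTimes (N - 2) τ)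
    {ζ : EuclideanSpace ℝ (Fin N)} (hζ : ζ ≠ 0)
    (h0 : ∀ z ∈ switchingNodes s τ, inner ℝ ζ (columnFlow A B i z) = 0) :
    (∀ j, inner ℝ ζ (columnFlowDeriv A B i 1 (s j)) ≠ 0) ∧
      ((∀ t ∈ Ioo 0 τ, bangBang s t * inner ℝ ζ (columnFlow A B i t) =
        |inner ℝ ζ (columnFlow A B i t)|) ∨
      ∀ t ∈ Ioo 0 τ, bangBang s t * -inner ℝ ζ (columnFlow A B i t) =
        |inner ℝ ζ (columnFlow A B i t)|) := by
  have hsub := switchingNodes_subset hτ hτT hs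
  have hcard := card_switchingNodes hs
  have hder : ∀ z ∈ switchingNodes s τ, inner ℝ ζ (columnFlowDeriv A B i 1 z) ≠ 0 := fun z hz =>
    h.deriv_ne_zero hζ (fun w hw => Ioc_subset_Icc_self (hsub w hw)) h0 (by omega) hz
  -- The nodes already account for `N - 1` zeros, so there is no room for another.
  have hzero : ∀ t ∈ Ioo 0 τ, inner ℝ ζ (columnFlow A B i t) = 0 ↔ switchingPoly s t = 0 := by
    intro t ht
    rw [switchingPoly_eq_zero_iff]
    constructor
    · intro htz
      by_contra hns
      have htn : t ∉ switchingNodes s τ := fun hmem =>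
        (mem_switchingNodes.1 hmem).elim (fun h => ht.2.ne h) hns
      refine (h.card_zeros_lt hζ (Z := insert t (switchingNodes s τ)) (fun z hz => ?_)
        fun z hz => ?_).ne (by rw [Finset.card_insert_of_notMem htn]; omega)
      · rcases Finset.mem_insert.1 hz with rfl | hz
        · exact ⟨ht.1.le, ht.2.le.trans hτT⟩
        · exact Ioc_subset_Icc_self (hsub z hz)
      · rcases Finset.mem_insert.1 hz with rfl | hz
        · exact htz
        · exact h0 z hz
    · rintro ⟨j, rfl⟩
      exact h0 _ (mem_switchingNodes.2 (Or.inr ⟨j, rfl⟩))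
  refine ⟨fun j => hder _ (mem_switchingNodes.2 (Or.inr ⟨j, rfl⟩)), ?_⟩
  have key := mul_nonneg_or_mul_nonpos_of_simple_zeros (a := 0) (b := τ)
    (hasDerivAt_inner_columnFlow A B i ζ) (hasDerivAt_switchingPoly s) hzero
    (fun t ht htz => by
      obtain ⟨j, rfl⟩ := switchingPoly_eq_zero_iff.1 ((hzero t ht).1 htz)
      exact neg_ne_zero.2 (hder _ (mem_switchingNodes.2 (Or.inr ⟨j, rfl⟩))))
    fun t _ htz => deriv_switchingPoly_ne_zero hs.2.injective htz
  refine key.imp (fun hk t ht => ?_) fun hk t ht => ?_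
  · exact bangBang_mul_eq_abs_of_mul_nonneg (hk t ht) (hzero t ht).2
  · rw [← abs_neg]
    refine bangBang_mul_eq_abs_of_mul_nonneg ?_ fun h => by rw [(hzero t ht).2 h, neg_zero]
    have := hk t ht
    linarith

/-- Every choice of `N - 2` switching times is realized by a functional vanishing at `τ`. -/
theorem IsDisconjugate.exists_normal_switching (h : IsDisconjugate A B i T) (hN : 2 < N)
    (hτ : 0 < τ) (hτT : τ ≤ T) {s : EuclideanSpace ℝ (Fin (N - 2))}
    (hs : s ∈ switchingTimes (N - 2) τ) :
    ∃ ζ : EuclideanSpace ℝ (Fin N), ‖ζ‖ = 1 ∧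
      (∀ z ∈ switchingNodes s τ, inner ℝ ζ (columnFlow A B i z) = 0) ∧
      (∀ j, inner ℝ ζ (columnFlowDeriv A B i 1 (s j)) ≠ 0) ∧
      ∀ t ∈ Ioo 0 τ, bangBang s t * inner ℝ ζ (columnFlow A B i t) =
        |inner ℝ ζ (columnFlow A B i t)| := by
  obtain ⟨ζ, hζ, h0⟩ := exists_unit_orthogonal (switchingNodes s τ) (columnFlow A B i) (by
    rw [card_switchingNodes hs, finrank_euclideanSpace_fin]; omega)
  have hne : ζ ≠ 0 := norm_ne_zero_iff.1 (by simp [hζ])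
  obtain ⟨hd, hsign | hsign⟩ := h.bangBang_mul_eq hN hτ hτT hs hne h0
  · exact ⟨ζ, hζ, h0, hd, hsign⟩
  · refine ⟨-ζ, by rwa [norm_neg], fun z hz => ?_, fun j => ?_, fun t ht => ?_⟩
    · rw [inner_neg_left, h0 z hz, neg_zero]
    · rw [inner_neg_left]; exact neg_ne_zero.2 (hd j)
    · rw [inner_neg_left, abs_neg]; exact hsign t ht

theorem isAdmissible_bangBang {d : ℕ} {s : EuclideanSpace ℝ (Fin d)}
    (hs : StrictMono fun j => s j) :
    IsAdmissible fun t (_ : Fin M) => bangBang s t := by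
  refine ⟨measurable_pi_lambda _ fun _ => measurable_bangBang hs, ae_of_all _ fun t _ => ?_⟩
  exact abs_le.1 (abs_bangBang s t).le

theorem contDiffOn_switchingMap (A : Matrix (Fin N) (Fin N) ℝ) (B : Matrix (Fin N) (Fin M) ℝ)
    (i : Fin M) (d : ℕ) (τ : ℝ) :
    ContDiffOn ℝ ∞ (switchingMap A (Bᵀ i) τ) (switchingTimes d τ) :=
  (contDiff_switchingSum (contDiff_columnFlow A B i) τ).contDiffOn.congr fun _ hs =>
    integral_bangBang_smul (continuous_columnFlow A B i) hs

theorem IsDisconjugate.fderiv_switchingMap_injective (h : IsDisconjugate A B i T) (hN : 2 < N)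
    (hτ : 0 < τ) (hτT : τ ≤ T) {s : EuclideanSpace ℝ (Fin (N - 2))}
    (hs : s ∈ switchingTimes (N - 2) τ) :
    Function.Injective (fderiv ℝ (switchingMap A (Bᵀ i) τ) s) := by
  have heq : switchingMap A (Bᵀ i) τ =ᶠ[𝓝 s] switchingSum (columnFlow A B i) τ := by
    filter_upwards [(isOpen_switchingTimes (N - 2) τ).mem_nhds hs] with r hr using
      integral_bangBang_smul (continuous_columnFlow A B i) hr
  rw [heq.fderiv_eq, injective_iff_map_eq_zero]
  intro v hv
  rw [fderiv_switchingSum_apply (continuous_columnFlow A B i)] at hv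
  ext k
  have := h.eq_zero_of_sum_smul hN hτ hτT hs hv k
  simpa using this

variable [Subsingleton (Fin M)]

theorem switchingMap_eq_integral_sum {d : ℕ} (s : EuclideanSpace ℝ (Fin d)) :
    switchingMap A (Bᵀ i) τ s =
      ∫ t in (0 : ℝ)..τ, ∑ j : Fin M, bangBang s t • columnFlow A B j t := by
  simp_rw [Fintype.sum_subsingleton _ i]
  rfl

/-- The two controls agree wherever `⟨ζ, g⟩` is nonzero, that is, almost everywhere; σ selects
between `X` and `-X`. -/
theorem extremal_eq_smul_switchingMap {d : ℕ} (hτ : 0 ≤ τ)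
    (h : FinitelyManySwitches (columnFlow A B) 0 τ) {ζ : EuclideanSpace ℝ (Fin N)} (hζ : ζ ≠ 0)
    {s : EuclideanSpace ℝ (Fin d)} (σ : ℝ)
    (hσ : ∀ t ∈ Ioo 0 τ, σ * bangBang s t * inner ℝ ζ (columnFlow A B i t) =
      |inner ℝ ζ (columnFlow A B i t)|) :
    extremal (columnFlow A B) 0 τ ζ = σ • switchingMap A (Bᵀ i) τ s := by
  rw [switchingMap_eq_integral_sum, ← intervalIntegral.integral_smul, extremal]
  refine intervalIntegral.integral_congr_ae ?_
  have hτ0 : ∀ᵐ t : ℝ, t ≠ τ := by simp [ae_iff]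
  filter_upwards [h.ae_ne_zero hζ, hτ0] with t ht htτ htI
  rw [uIoc_of_le hτ] at htI
  have htI' : t ∈ Ioo 0 τ := ⟨htI.1, lt_of_le_of_ne htI.2 htτ⟩
  have hne := ht (Ioo_subset_Icc_self htI') i
  have : signPM (inner ℝ ζ (columnFlow A B i t)) = σ * bangBang s t :=
    mul_right_cancel₀ hne ((signPM_mul_self _).trans (hσ t htI').symm)
  simp_rw [Fintype.sum_subsingleton _ i]
  rw [this, mul_smul]

/-- The normal ζ belonging to `s` is maximized by the control of `s`. If `r` gives the same point,
its control is also optimal, so `⟨ζ, g⟩` and the switching polynomial of `r` have the same sign; the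
simple zeros `s j` of the former must be zeros of the latter. Symmetry and ordering finish. -/
theorem IsDisconjugate.injOn_switchingMap (h : IsDisconjugate A B i T) (hN : 2 < N)
    (hτ : 0 < τ) (hτT : τ ≤ T) :
    InjOn (switchingMap A (Bᵀ i) τ) (switchingTimes (N - 2) τ) := by
  have hg := continuous_columnFlow A B
  have hsub : ∀ s ∈ switchingTimes (N - 2) τ, ∀ r ∈ switchingTimes (N - 2) τ,
      switchingMap A (Bᵀ i) τ s = switchingMap A (Bᵀ i) τ r →
      range (fun j => s j) ⊆ range fun j => r j := by
    rintro s hs r hr hsr _ ⟨j, rfl⟩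
    obtain ⟨ζ, -, h0, hd, hsign⟩ := h.exists_normal_switching hN hτ hτT hs
    have hfc : Continuous fun t => inner ℝ ζ (columnFlow A B i t) := continuous_const.inner (hg i)
    have hinner : ∀ u ∈ switchingTimes (N - 2) τ, inner ℝ ζ (switchingMap A (Bᵀ i) τ u) =
        ∫ t in (0 : ℝ)..τ, bangBang u t * inner ℝ ζ (columnFlow A B i t) := by
      intro u hu
      rw [switchingMap_eq_integral_sum,
        inner_integral_control (isAdmissible_bangBang (M := M) hu.2) hg]
      simp_rw [Fintype.sum_subsingleton _ i]
    have hint : ∀ u ∈ switchingTimes (N - 2) τ, IntervalIntegrable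
        (fun t => bangBang u t * inner ℝ ζ (columnFlow A B i t)) volume 0 τ := by
      intro u hu
      have := (isAdmissible_bangBang (M := M) hu.2).intervalIntegrable_inner hg 0 τ ζ
      simpa only [Fintype.sum_subsingleton _ i] using this
    have hzero : ∫ t in (0 : ℝ)..τ, (bangBang s t * inner ℝ ζ (columnFlow A B i t) -
        bangBang r t * inner ℝ ζ (columnFlow A B i t)) = 0 := by
      rw [intervalIntegral.integral_sub (hint s hs) (hint r hr), ← hinner s hs, ← hinner r hr, hsr,
        sub_self]
    have hle : ∀ t ∈ Ioo 0 τ, bangBang r t * inner ℝ ζ (columnFlow A B i t) ≤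
        bangBang s t * inner ℝ ζ (columnFlow A B i t) := by
      intro t ht
      rw [hsign t ht]
      refine (le_abs_self _).trans ?_
      rw [abs_mul, abs_bangBang, one_mul]
    rw [intervalIntegral.integral_of_le hτ.le, integral_Ioc_eq_integral_Ioo] at hzero
    have hIoo : IntegrableOn (fun t => bangBang s t * inner ℝ ζ (columnFlow A B i t) -
        bangBang r t * inner ℝ ζ (columnFlow A B i t)) (Ioo 0 τ) volume :=
      (((hint s hs).sub (hint r hr)).1).mono_set Ioo_subset_Ioc_self
    have hae := (setIntegral_eq_zero_iff_of_nonneg_ae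
      ((ae_restrict_iff' measurableSet_Ioo).2 (ae_of_all _ fun t ht => sub_nonneg.2 (hle t ht)))
      hIoo).1 hzero
    have hpc : Continuous (switchingPoly r) :=
      continuous_iff_continuousAt.2 fun t => (hasDerivAt_switchingPoly r t).continuousAt
    -- Truncating by `min 0` turns an almost everywhere inequality into an equality of continuous
    -- functions, which then holds everywhere on the open interval.
    have hmin : EqOn (fun t => min 0 (inner ℝ ζ (columnFlow A B i t) * switchingPoly r t))
        (fun _ => 0) (Ioo 0 τ) := by
      refine Measure.eqOn_open_of_ae_eq (μ := volume) ?_ isOpen_Ioo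
        (by fun_prop) continuousOn_const
      filter_upwards [hae, ae_restrict_mem measurableSet_Ioo] with t ht htI
      have h1 : bangBang r t * inner ℝ ζ (columnFlow A B i t) =
          |inner ℝ ζ (columnFlow A B i t)| := by
        rw [← hsign t htI]
        simp only [Pi.zero_apply] at ht
        linarith
      refine min_eq_left ?_
      rw [← bangBang_mul_abs_switchingPoly, mul_left_comm, ← mul_assoc, h1]
      positivity
    have hev : ∀ᶠ t in 𝓝 (s j), 0 ≤ inner ℝ ζ (columnFlow A B i t) * switchingPoly r t := by
      filter_upwards [isOpen_Ioo.mem_nhds (hs.1 j)] with t ht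
      exact min_eq_left_iff.1 (hmin ht)
    exact switchingPoly_eq_zero_iff.1 (eq_zero_of_mul_nonneg_of_simple_zero
      (hasDerivAt_inner_columnFlow A B i ζ (s j)) (hasDerivAt_switchingPoly r (s j))
      (h0 _ (mem_switchingNodes.2 (Or.inr ⟨j, rfl⟩))) (neg_ne_zero.2 (hd j)) hev)
  intro s hs r hr hsr
  have := (StrictMono.range_inj hs.2 hr.2).1
    (Subset.antisymm (hsub s hs r hr hsr) (hsub r hr s hs hsr.symm))
  ext j
  exact congrFun this j

theorem IsDisconjugate.switchingMap_mem_nonLipFront (h : IsDisconjugate A B i T) (hN : 2 < N)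
    (hFMS : FinitelyManySwitches (columnFlow A B) 0 T) (hτ : 0 < τ) (hτT : τ < T)
    {s : EuclideanSpace ℝ (Fin (N - 2))} (hs : s ∈ switchingTimes (N - 2) τ) :
    switchingMap A (Bᵀ i) τ s ∈ nonLipFront A B τ ∧
      -switchingMap A (Bᵀ i) τ s ∈ nonLipFront A B τ := by
  have hg := continuous_columnFlow A B
  obtain ⟨ζ, hζ, h0, -, hsign⟩ := h.exists_normal_switching hN hτ hτT.le hs
  have hne : ζ ≠ 0 := norm_ne_zero_iff.1 (by simp [hζ])
  have hτ0 : ∀ j, inner ℝ ζ (columnFlow A B j τ) = 0 := fun j =>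
    Subsingleton.elim i j ▸ h0 τ (mem_switchingNodes.2 (Or.inl rfl))
  have hFMS' := hFMS.mono le_rfl hτT.le
  have hmem : ∀ ξ : EuclideanSpace ℝ (Fin N), ‖ξ‖ = 1 →
      (∀ j, inner ℝ ξ (columnFlow A B j τ) = 0) →
      extremal (columnFlow A B) 0 τ ξ ∈ nonLipFront A B τ := fun ξ hξ hξ0 =>
    mem_nonLipFront_of_normal (Fin.pos i) hFMS hτ hτT (extremal_mem_steerSet hg 0 τ ξ) hξ hξ0
      (inner_extremal hg 0 τ ξ).ge
  have h1 := extremal_eq_smul_switchingMap hτ.le hFMS' hne 1 (by simpa using hsign)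
  have h2 := extremal_eq_smul_switchingMap (i := i) hτ.le hFMS' (neg_ne_zero.2 hne) (s := s) (-1)
    (by simpa using hsign)
  rw [one_smul] at h1
  rw [neg_one_smul] at h2
  refine ⟨h1 ▸ hmem ζ hζ hτ0, h2 ▸ hmem (-ζ) (by rwa [norm_neg]) fun j => ?_⟩
  rw [inner_neg_left, hτ0 j, neg_zero]

/-- The normal vanishes on the flow at τ, which uses up one of the at most `N - 1` zeros. Having `N
- 2` interior zeros gives `±X`; otherwise the point lies in the lower strata. -/
theorem IsDisconjugate.nonLipFront_subset (h : IsDisconjugate A B i T) (hN : 2 < N)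
    (hFMS : FinitelyManySwitches (columnFlow A B) 0 T) (hτ : 0 < τ) (hτT : τ < T) :
    nonLipFront A B τ ⊆
      ((switchingMap A (Bᵀ i) τ '' switchingTimes (N - 2) τ) ∪
        ((fun s => -switchingMap A (Bᵀ i) τ s) '' switchingTimes (N - 2) τ)) ∪
      {x | ∃ (Z : Finset ℝ) (c₀ : ℤ) (c : ℝ → ℤ), Z.card < N - 2 ∧
        x = c₀ • (∫ t in (0 : ℝ)..τ, columnFlow A B i t) +
          ∑ z ∈ Z, c z • ∫ t in (0 : ℝ)..z, columnFlow A B i t} := by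
  classical
  intro x hx
  obtain ⟨ζ, hζ, hτ0, rfl⟩ := exists_normal_of_mem_nonLipFront (Fin.pos i) hFMS hτ hτT hx
  have hne : ζ ≠ 0 := norm_ne_zero_iff.1 (by simp [hζ])
  have hfin : {t ∈ Ioo 0 τ | inner ℝ ζ (columnFlow A B i t) = 0}.Finite :=
    (h.finite_zeros hne).subset fun t ht => ⟨⟨ht.1.1.le, ht.1.2.le.trans hτT.le⟩, ht.2⟩
  set Z := hfin.toFinset with hZ
  have hZmem : ∀ t, t ∈ Z ↔ t ∈ Ioo 0 τ ∧ inner ℝ ζ (columnFlow A B i t) = 0 := fun t => by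
    simp [hZ]
  have hτZ : τ ∉ Z := fun hmem => ((hZmem τ).1 hmem).1.2.false
  have hcard : Z.card + 1 < N := by
    rw [← Finset.card_insert_of_notMem hτZ]
    refine h.card_zeros_lt hne (fun z hz => ?_) fun z hz => ?_
    · rcases Finset.mem_insert.1 hz with rfl | hz
      · exact ⟨hτ.le, hτT.le⟩
      · have := ((hZmem z).1 hz).1
        exact ⟨this.1.le, this.2.le.trans hτT.le⟩
    · rcases Finset.mem_insert.1 hz with rfl | hz
      · exact hτ0 i
      · exact ((hZmem z).1 hz).2
  rcases (show Z.card ≤ N - 2 by omega).eq_or_lt with heq | hlt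
  · left
    let s : EuclideanSpace ℝ (Fin (N - 2)) := WithLp.toLp 2 (Z.orderEmbOfFin heq)
    have hsZ : ∀ j, s j ∈ Z := Z.orderEmbOfFin_mem heq
    have hs : s ∈ switchingTimes (N - 2) τ :=
      ⟨fun j => ((hZmem _).1 (hsZ j)).1, (Z.orderEmbOfFin heq).strictMono⟩
    obtain ⟨-, hsign⟩ := h.bangBang_mul_eq hN hτ hτT.le hs hne fun z hz => by
      rcases mem_switchingNodes.1 hz with rfl | ⟨j, rfl⟩
      · exact hτ0 i
      · exact ((hZmem _).1 (hsZ j)).2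
    rcases hsign with hsign | hsign
    · left
      refine ⟨s, hs, ?_⟩
      rw [extremal_eq_smul_switchingMap (i := i) hτ.le (hFMS.mono le_rfl hτT.le) hne (s := s) 1
        (by simpa using hsign), one_smul]
    · right
      refine ⟨s, hs, ?_⟩
      rw [extremal_eq_smul_switchingMap (i := i) hτ.le (hFMS.mono le_rfl hτT.le) hne (s := s) (-1)
        (by simpa using hsign), neg_one_smul]
  · right
    have hfc : Continuous fun t => inner ℝ ζ (columnFlow A B i t) :=
      continuous_const.inner (continuous_columnFlow A B i)
    obtain ⟨c₀, c, hc⟩ := exists_integral_signPM_eq_sum hfc (continuous_columnFlow A B i) Z τ hτ.le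
      (fun z hz => ((hZmem z).1 hz).1) fun t ht htZ h0 => htZ ((hZmem t).2 ⟨ht, h0⟩)
    refine ⟨Z, c₀, c, hlt, ?_⟩
    rw [← hc, extremal]
    simp_rw [Fintype.sum_subsingleton _ i]

end SingleInput

end MinTime

theorem theorem7p1 (N M : ℕ) (hN : 2 < N) (hM : 1 ≤ M) (hMN : M ≤ N)
    (A : Matrix (Fin N) (Fin N) ℝ) (B : Matrix (Fin N) (Fin M) ℝ)
    (hnormal : MinTime.IsNormal A B) (hrank : B.rank < N) :
    ∃ τ₀ : ℝ, 0 < τ₀ ∧ ∀ τ : ℝ, 0 < τ → τ ≤ τ₀ →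
      (∀ᵐ x ∂(μH[(N : ℝ) - 1 - (B.rank : ℝ)] : Measure (EuclideanSpace ℝ (Fin N))),
        x ∈ MinTime.nonLipFront A B τ → ∀ V ∈ 𝓝 x,
          0 < (μH[(N : ℝ) - 1 - (B.rank : ℝ)] : Measure (EuclideanSpace ℝ (Fin N)))
            (V ∩ MinTime.nonLipFront A B τ)) ∧
      0 < (μH[(N : ℝ) - 1 - (B.rank : ℝ)] : Measure (EuclideanSpace ℝ (Fin N)))
        (MinTime.nonLipFront A B τ) ∧
      (M = 1 → ∀ i : Fin M,
        MinTime.IsSmoothSurfaceOn (d := N - 2) (MinTime.switchingMap A (Bᵀ i) τ)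
          (MinTime.switchingTimes (N - 2) τ) ∧
        MinTime.IsSmoothSurfaceOn (d := N - 2) (fun s => -MinTime.switchingMap A (Bᵀ i) τ s)
          (MinTime.switchingTimes (N - 2) τ) ∧
        (MinTime.switchingMap A (Bᵀ i) τ '' MinTime.switchingTimes (N - 2) τ) ∪
            ((fun s => -MinTime.switchingMap A (Bᵀ i) τ s) '' MinTime.switchingTimes (N - 2) τ) ⊆
          MinTime.nonLipFront A B τ ∧
        (μH[(N : ℝ) - 2] : Measure (EuclideanSpace ℝ (Fin N)))
          (MinTime.nonLipFront A B τ \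
            ((MinTime.switchingMap A (Bᵀ i) τ '' MinTime.switchingTimes (N - 2) τ) ∪
            ((fun s => -MinTime.switchingMap A (Bᵀ i) τ s) ''
              MinTime.switchingTimes (N - 2) τ))) = 0) := by
  obtain ⟨T, hT, hdis, hFMS⟩ := MinTime.exists_finitelyManySwitches hnormal
  -- Halving keeps `τ < T`: extra time beyond τ is needed to reach a full neighborhood of a boundary
  -- point.
  refine ⟨T / 2, by positivity, fun τ hτ hτ₀ => ?_⟩
  have hτT : τ < T := by linarith
  refine ⟨MinTime.ae_pos_measure_nhds_inter _ _,
    MinTime.hausdorffMeasure_nonLipFront_pos hM hFMS hτ hτT hrank, fun hM1 i => ?_⟩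
  have : Subsingleton (Fin M) := by subst hM1; infer_instance
  have hinj := (hdis i).injOn_switchingMap hN hτ hτT.le
  have hopen := MinTime.isOpen_switchingTimes (N - 2) τ
  have hsmooth := MinTime.contDiffOn_switchingMap A B i (N - 2) τ
  have hder := fun s hs => (hdis i).fderiv_switchingMap_injective hN hτ hτT.le (s := s) hs
  refine ⟨⟨hopen, hsmooth, hinj, hder⟩, ⟨hopen, hsmooth.neg, fun s hs r hr hsr =>
    hinj hs hr (neg_injective hsr), fun s hs => ?_⟩, ?_, ?_⟩
  · rw [fderiv_fun_neg]
    exact neg_injective.comp (hder s hs)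
  · rintro x (⟨s, hs, rfl⟩ | ⟨s, hs, rfl⟩)
    · exact ((hdis i).switchingMap_mem_nonLipFront hN hFMS hτ hτT hs).1
    · exact ((hdis i).switchingMap_mem_nonLipFront hN hFMS hτ hτT hs).2
  · have hexp : (N : ℝ) - 2 = ((N - 2 : ℕ) : ℝ) := by
      rw [Nat.cast_sub hN.le, Nat.cast_ofNat]
    rw [hexp]
    refine measure_mono_null (sdiff_subset_iff.2 ((hdis i).nonLipFront_subset hN hFMS hτ hτT))
      (MinTime.hausdorffMeasure_integer_combinations ?_ _ _)
    exact (MinTime.contDiff_primitive (MinTime.contDiff_columnFlow A B i)).of_le (by simp)
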